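/- Let $H_{11}\in\mathbb{C}^{M_1\times N_1}$, $H_{11}\ne 0$, and $H_{21}\in\mathbb{C}^{M_1\times N_2}$ be the channels from users 1 and 2 to receiver 1 (unit-covariance noise), let $S_2\succeq 0$ and $r_2\in\mathbb{R}$ be the fixed transmit covariance and rate of user 2, and let $P_1>0$. Write $|\cdot|$ for the determinant, $\log$ for the natural logarithm, $\mathcal{F}=\{S_1\succeq 0:\operatorname{tr}S_1\le P_1\}$, and $$A(S_1)=\log|I+H_{11}S_1H_{11}^H|,\qquad B(S_1)=\log|I+H_{11}S_1H_{11}^H+H_{21}S_2H_{21}^H|,$$ $$R_2^{(a)}(S_1)=\log|I+(I+H_{11}S_1H_{11}^H)^{-1}H_{21}S_2H_{21}^H|,\qquad R_2^{(b)}=\log|I+H_{21}S_2H_{21}^H|.$$ For $S_1\in\mathcal F$, opportunistic multiuser detection (OMD) uses successive decoding (SD) if $r_2\le R_2^{(a)}(S_1)$, joint decoding (JD) if $R_2^{(a)}(S_1)<r_2\le R_2^{(b)}$, and single-user decoding (SUD) if $r_2>R_2^{(b)}$, with rates $$r_1(S_1)=\begin{cases}A(S_1), & r_2\le R_2^{(a)}(S_1),\\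 B(S_1)-r_2, & R_2^{(a)}(S_1)<r_2\le R_2^{(b)},\\ \log|I+(I+H_{21}S_2H_{21}^H)^{-1}H_{11}S_1H_{11}^H|, & r_2>R_2^{(b)}.\end{cases}$$ Problem (P1) is to maximize $r_1(S_1)$ over $S_1\in\mathcal F$; write $S_1^{\rm OMD}$ and $r_1^{\rm OMD}$ for its optimal solution and optimal value. For a matrix $H\in\mathbb{C}^{M_1\times N_1}$ with thin singular-value decomposition $H=U\,\mathrm{diag}(\sigma_1,\dots,\sigma_T)V^H$, $T=\min(N_1,M_1)$, the water-filling solution on $H$ is $V\,\mathrm{diag}(p_1,\dots,p_T)V^H$ with $p_i=(\mu-1/\sigma_i^2)^+$ ($p_i=0$ if $\sigma_i=0$), where $\mu$ is such that $\sum_i p_i=P_1$; its rate is $\sum_i\log(1+\sigma_i^2p_i)$. Let $(S_1^{\rm SD},r_1^{\rm SD})$ be the water-filling solution on $H_{11}$ and its rate, let $(S_1^{\rm SUD},r_1^{\rm SUD})$ be those on the whitened channel $(I+H_{21}S_2H_{21}^H)^{-1/2}H_{11}$, and put $\hat R_2^{(a)}=R_2^{(a)}(S_1^{\rm SD})$,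 $\bar R_2^{(a)}=R_2^{(a)}(S_1^{\rm SUD})$. Finally, let $$g(\mu_1,\mu_2)=\sup_{r_1\ge 0,\;S_1\in\mathcal F}\ \bigl[r_1-\mu_1\bigl(r_1-A(S_1)\bigr)-\mu_2\bigl(r_1-B(S_1)+r_2\bigr)\bigr]\in(-\infty,+\infty],$$ let $(\mu_1^*,\mu_2^*)$ be any minimizer of $g$ over $\mu_1,\mu_2\ge 0$, and let $\tilde S_1^{\rm SD}$ be any maximizer of $\mu_1^*A(S_1)+(1-\mu_1^*)B(S_1)$ over $\mathcal F$. Then the two water-filling solutions exist, $\hat R_2^{(a)}\le\bar R_2^{(a)}\le R_2^{(b)}$, and in each of the following cases (P1) has exactly one optimal solution $S_1^{\rm OMD}$, which, together with $r_1^{\rm OMD}$ and the decoding method that OMD uses at $S_1^{\rm OMD}$, is as follows: 1. if $0<r_2<\hat R_2^{(a)}$, then $S_1^{\rm OMD}=S_1^{\rm SD}$ and $r_1^{\rm OMD}=r_1^{\rm SD}$, with SD; 2. if $\hat R_2^{(a)}\le r_2\le\bar R_2^{(a)}$, then $(\mu_1^*,\mu_2^*)$ and $\tilde S_1^{\rm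 SD}$ exist, and for every choice of them $S_1^{\rm OMD}=\tilde S_1^{\rm SD}$ and $r_1^{\rm OMD}=A(\tilde S_1^{\rm SD})$, with SD; 3. if $\bar R_2^{(a)}<r_2\le R_2^{(b)}$, then $S_1^{\rm OMD}=S_1^{\rm SUD}$ and $r_1^{\rm OMD}=r_1^{\rm SUD}+R_2^{(b)}-r_2$, with JD; 4. if $r_2>R_2^{(b)}$, then $S_1^{\rm OMD}=S_1^{\rm SUD}$ and $r_1^{\rm OMD}=r_1^{\rm SUD}$, with SUD. -/

import Mathlib

open Matrix
open scoped ComplexOrder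

noncomputable section

namespace OMD

/-- `log |A|` for a square complex matrix (natural logarithm).  It is used only for matrices whose
determinant is a positive real number. -/
def logDet {m : ℕ} (A : Matrix (Fin m) (Fin m) ℂ) : ℝ := Real.log A.det.re

/-- The received covariance `H S Hᴴ` of a signal with transmit covariance `S` sent through the
channel `H`. -/
def rx {m n : ℕ} (H : Matrix (Fin m) (Fin n) ℂ) (S : Matrix (Fin n) (Fin n) ℂ) :
    Matrix (Fin m) (Fin m) ℂ := H * S * Hᴴ

/-- The constraint set of the covariance of user 1: `S ⪰ 0` and `tr S ≤ P`. -/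
def feasible (n : ℕ) (P : ℝ) : Set (Matrix (Fin n) (Fin n) ℂ) :=
  {S | S.PosSemidef ∧ S.trace.re ≤ P}

section Rates

variable {m n₁ n₂ : ℕ} (H₁₁ : Matrix (Fin m) (Fin n₁) ℂ) (H₂₁ : Matrix (Fin m) (Fin n₂) ℂ)
  (S₂ : Matrix (Fin n₂) (Fin n₂) ℂ)

/-- `log |I + H₁₁ S₁ H₁₁ᴴ|`: the capacity of user 1 without the presence of user 2. -/
def ownRate (S₁ : Matrix (Fin n₁) (Fin n₁) ℂ) : ℝ := logDet (1 + rx H₁₁ S₁)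

/-- `log |I + H₁₁ S₁ H₁₁ᴴ + H₂₁ S₂ H₂₁ᴴ|`: the sum rate at the receiver of user 1. -/
def sumRate (S₁ : Matrix (Fin n₁) (Fin n₁) ℂ) : ℝ := logDet (1 + rx H₁₁ S₁ + rx H₂₁ S₂)

/-- `log |I + (I + H₂₁ S₂ H₂₁ᴴ)⁻¹ H₁₁ S₁ H₁₁ᴴ|`: the rate of user 1 when user 2 is treated as
colored Gaussian noise. -/
def noiseRate (S₁ : Matrix (Fin n₁) (Fin n₁) ℂ) : ℝ :=
  logDet (1 + (1 + rx H₂₁ S₂)⁻¹ * rx H₁₁ S₁)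

/-- `R₂⁽ᵃ⁾`, as a function of `S₁`. -/
def Ra (S₁ : Matrix (Fin n₁) (Fin n₁) ℂ) : ℝ :=
  logDet (1 + (1 + rx H₁₁ S₁)⁻¹ * rx H₂₁ S₂)

/-- `R₂⁽ᵇ⁾`, which does not depend on `S₁`. -/
def Rb : ℝ := logDet (1 + rx H₂₁ S₂)

/-- Successive decoding, joint decoding, and single-user decoding. -/
inductive Decoding
  | SD
  | JD
  | SUD

/-- The decoding method that opportunistic multiuser detection uses for a given `S₁`: successive
decoding under strong interference, joint decoding under moderate interference, and single-user
decoding under weak interference. -/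
def omdDecoding (r₂ : ℝ) (S₁ : Matrix (Fin n₁) (Fin n₁) ℂ) : Decoding :=
  open scoped Classical in
  if r₂ ≤ Ra H₁₁ H₂₁ S₂ S₁ then .SD else if r₂ ≤ Rb H₂₁ S₂ then .JD else .SUD

/-- The maximum rate of user 1 under each decoding method. -/
def decodingRate (r₂ : ℝ) (S₁ : Matrix (Fin n₁) (Fin n₁) ℂ) : Decoding → ℝ
  | .SD => ownRate H₁₁ S₁
  | .JD => sumRate H₁₁ H₂₁ S₂ S₁ - r₂
  | .SUD => noiseRate H₁₁ H₂₁ S₂ S₁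

/-- The rate `r₁(S₁)` of user 1 with opportunistic multiuser detection. -/
def omdRate (r₂ : ℝ) (S₁ : Matrix (Fin n₁) (Fin n₁) ℂ) : ℝ :=
  decodingRate H₁₁ H₂₁ S₂ r₂ S₁ (omdDecoding H₁₁ H₂₁ S₂ r₂ S₁)

/-- `S` is the (unique) optimal covariance of problem (P1), `r` is the optimal value, and `d` is
the decoding method used at the optimum. -/
structure IsOMDSolution (P r₂ : ℝ) (S : Matrix (Fin n₁) (Fin n₁) ℂ) (r : ℝ) (d : Decoding) :
    Prop where
  optimal_iff : ∀ S' : Matrix (Fin n₁) (Fin n₁) ℂ,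
    (S' ∈ feasible n₁ P ∧ IsMaxOn (omdRate H₁₁ H₂₁ S₂ r₂) (feasible n₁ P) S') ↔ S' = S
  value_eq : omdRate H₁₁ H₂₁ S₂ r₂ S = r
  decoding_eq : omdDecoding H₁₁ H₂₁ S₂ r₂ S = d

/-- The Lagrangian of the problem (P2) of maximizing `r₁` subject to `r₁ ≤ ownRate S₁`,
`r₁ ≤ sumRate S₁ - r₂`, `r₁ ≥ 0`, and `S₁` feasible; only the two rate constraints are
dualized. -/
def lagrangian (r₂ r₁ : ℝ) (S₁ : Matrix (Fin n₁) (Fin n₁) ℂ) (μ₁ μ₂ : ℝ) : ℝ :=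
  r₁ - μ₁ * (r₁ - ownRate H₁₁ S₁) - μ₂ * (r₁ - sumRate H₁₁ H₂₁ S₂ S₁ + r₂)

/-- The Lagrange dual function of (P2); its value may be `+∞`. -/
def dualFun (P r₂ μ₁ μ₂ : ℝ) : EReal :=
  ⨆ x : {x : ℝ × Matrix (Fin n₁) (Fin n₁) ℂ // 0 ≤ x.1 ∧ x.2 ∈ feasible n₁ P},
    ((lagrangian H₁₁ H₂₁ S₂ r₂ x.1.1 x.1.2 μ₁ μ₂ : ℝ) : EReal)

/-- `(μ₁, μ₂)` is an optimal solution of the dual problem (P2-D). -/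
def IsDualOptimal (P r₂ μ₁ μ₂ : ℝ) : Prop :=
  0 ≤ μ₁ ∧ 0 ≤ μ₂ ∧ ∀ ν₁ ν₂ : ℝ, 0 ≤ ν₁ → 0 ≤ ν₂ →
    dualFun H₁₁ H₂₁ S₂ P r₂ μ₁ μ₂ ≤ dualFun H₁₁ H₂₁ S₂ P r₂ ν₁ ν₂

/-- `S` is an optimal solution of (P3) with weight `μ₁`. -/
def IsP3Solution (P μ₁ : ℝ) (S : Matrix (Fin n₁) (Fin n₁) ℂ) : Prop :=
  S ∈ feasible n₁ P ∧
    IsMaxOn (fun S' => μ₁ * ownRate H₁₁ S' + (1 - μ₁) * sumRate H₁₁ H₂₁ S₂ S')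
      (feasible n₁ P) S

open scoped MatrixOrder Matrix.Norms.L2Operator in
/-- The equivalent channel of user 1 after noise whitening,
`(I + H₂₁ S₂ H₂₁ᴴ)^(-1/2) H₁₁`. -/
def whitened : Matrix (Fin m) (Fin n₁) ℂ := CFC.sqrt ((1 + rx H₂₁ S₂)⁻¹) * H₁₁

end Rates

/-- The power allotted to a mode of gain `σ` at water level `μ`: `(μ - 1/σ²)⁺`, where
`1/0² = +∞`. -/
def waterPower (μ σ : ℝ) : ℝ := if σ = 0 then 0 else max (μ - 1 / σ ^ 2) 0

/-- `S` is the water-filling covariance for the channel `H` and the power `P`, and `r` is the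
corresponding rate: `H = U Σ Vᴴ` is a thin singular-value decomposition, `S = V Λ Vᴴ` with the
water-filling powers on the diagonal of `Λ`, and `r = ∑ log (1 + σᵢ² pᵢ)`. -/
def IsWaterFilling {m n : ℕ} (H : Matrix (Fin m) (Fin n) ℂ) (P : ℝ)
    (S : Matrix (Fin n) (Fin n) ℂ) (r : ℝ) : Prop :=
  ∃ (U : Matrix (Fin m) (Fin (min n m)) ℂ) (V : Matrix (Fin n) (Fin (min n m)) ℂ)
    (σ : Fin (min n m) → ℝ) (μ : ℝ),
    Uᴴ * U = 1 ∧ Vᴴ * V = 1 ∧ (∀ i, 0 ≤ σ i) ∧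
    H = U * diagonal (fun i => (σ i : ℂ)) * Vᴴ ∧
    ∑ i, waterPower μ (σ i) = P ∧
    S = V * diagonal (fun i => (waterPower μ (σ i) : ℂ)) * Vᴴ ∧
    r = ∑ i, Real.log (1 + σ i ^ 2 * waterPower μ (σ i))

end OMD

end

namespace OMD

/-! Write `A` and `B` for the own rate and the sum rate. Factoring determinants gives `Ra = B - A`
(`Ra_eq`), so for `r₂ ≤ Rb` the opportunistic rate is `min A (B - r₂)` (`omdRate_of_le`). Since `Ra
≤ Rb` (`Ra_le_Rb`), for `r₂ > Rb` only single-user decoding occurs, and the rate is `B - Rb`.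
Water-filling on `H₁₁` maximizes `A`, and water-filling on the whitened channel maximizes `B`
(`IsWaterFilling.optimal`). When the smaller of `A` and `B - r₂` at the maximizer of one of them is
that function itself, this point also maximizes the minimum; this settles the extreme regimes.

In the middle regime let `v` be the maximum of `min A (B - r₂)`. Separating convex sets in the plane
yields a convex combination of the two concave functions bounded by `v`
(`exists_convex_combination_le`). Hence the dual optimum has value `v`, and positivity of `v` forces
every optimal pair of multipliers to sum to one (`dual_optimum_spec`). A maximin point then
maximizes the weighted sum. If the weight of `A` is positive, complementary slackness gives `A = v`;
if it is zero, the point is the maximizer of `B`. Either way the decoding is successive.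

Uniqueness holds although `S ↦ H S Hᴴ` need not be injective: strict concavity of `log |·|` fixes
the received covariance, and an optimal covariance wastes no power on the kernel of `H`
(`weighted_rate_maximizer_unique`). -/

/-! ### Log-determinant inequalities. -/

open scoped MatrixOrder in
lemma exists_eq_conjTranspose_mul_self {m : ℕ} {A : Matrix (Fin m) (Fin m) ℂ}
    (hA : A.PosSemidef) : ∃ B : Matrix (Fin m) (Fin m) ℂ, A = Bᴴ * B := by
  have h := nonneg_iff_posSemidef.mpr hA
  rw [CStarAlgebra.nonneg_iff_eq_star_mul_self] at h
  exact h

lemma det_re_pos {m : ℕ} {A : Matrix (Fin m) (Fin m) ℂ} (hA : A.PosDef) : 0 < A.det.re :=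
  (Complex.lt_def.mp hA.det_pos).1

lemma det_eq_ofReal_re {m : ℕ} {A : Matrix (Fin m) (Fin m) ℂ} (hA : A.PosSemidef) :
    A.det = (A.det.re : ℂ) :=
  Complex.ext rfl (by simpa using (Complex.le_def.mp hA.det_nonneg).2.symm)

/-- `log |Z| ≤ tr Z - m` for positive definite `Z`, with equality only at `Z = 1`. -/
lemma logDet_le_trace_sub {m : ℕ} {Z : Matrix (Fin m) (Fin m) ℂ} (hZ : Z.PosDef) :
    logDet Z ≤ Z.trace.re - m ∧ (Z.trace.re - m ≤ logDet Z → Z = 1) := by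
  have hdet : logDet Z = ∑ i, Real.log (hZ.1.eigenvalues i) := by
    rw [logDet, hZ.1.det_eq_prod_eigenvalues]
    have : ((∏ i, ((hZ.1.eigenvalues i : ℝ) : ℂ)) : ℂ).re = ∏ i, hZ.1.eigenvalues i := by
      rw [← Complex.ofReal_prod, Complex.ofReal_re]
    erw [this, Real.log_prod (fun i _ => (hZ.eigenvalues_pos i).ne')]
  have htr : Z.trace.re - m = ∑ i, (hZ.1.eigenvalues i - 1) := by
    rw [hZ.1.trace_eq_sum_eigenvalues]
    simp
  have hle : ∀ i ∈ Finset.univ, Real.log (hZ.1.eigenvalues i) ≤ hZ.1.eigenvalues i - 1 :=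
    fun i _ => Real.log_le_sub_one_of_pos (hZ.eigenvalues_pos i)
  rw [hdet, htr]
  refine ⟨Finset.sum_le_sum hle, fun h => ?_⟩
  have heq := (Finset.sum_eq_sum_iff_of_le hle).mp (le_antisymm (Finset.sum_le_sum hle) h)
  have hone : ∀ i, hZ.1.eigenvalues i = 1 := by
    intro i
    by_contra hne
    exact (Real.log_lt_sub_one_of_pos (hZ.eigenvalues_pos i) hne).ne (heq i (Finset.mem_univ i))
  rw [hZ.1.spectral_theorem]
  have : (RCLike.ofReal ∘ hZ.1.eigenvalues : Fin m → ℂ) = fun _ => 1 := by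
    funext i; simp [hone i]
  rw [this, diagonal_one, map_one]

/-- The first-order upper bound of the concave function `log |·|`, and its equality case. -/
lemma logDet_le_add_trace {m : ℕ} {X Y : Matrix (Fin m) (Fin m) ℂ} (hX : X.PosDef)
    (hY : Y.PosDef) :
    logDet Y ≤ logDet X + (X⁻¹ * (Y - X)).trace.re ∧
      (logDet X + (X⁻¹ * (Y - X)).trace.re ≤ logDet Y → Y = X) := by
  -- With `X⁻¹ = Bᴴ B`, congruence by `B` sends `X` to the identity and reduces the claim to the
  -- trace bound for `B Y Bᴴ`.
  obtain ⟨B, hB⟩ := exists_eq_conjTranspose_mul_self hX.inv.posSemidef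
  have hXu : IsUnit X.det := (Matrix.isUnit_iff_isUnit_det _).mp hX.isUnit
  have hdetB : star B.det * B.det * X.det = 1 := by
    rw [← det_conjTranspose, ← det_mul, ← hB, ← det_mul, nonsing_inv_mul _ hXu, det_one]
  have hBu : IsUnit B.det := by
    refine isUnit_iff_ne_zero.mpr fun h => ?_
    simp [h] at hdetB
  have hZ : (B * Y * Bᴴ).PosDef :=
    hY.mul_mul_conjTranspose_same
      (Matrix.vecMul_injective_of_isUnit ((Matrix.isUnit_iff_isUnit_det _).mpr hBu))
  have hlog : logDet (B * Y * Bᴴ) = logDet Y - logDet X := by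
    have h1 : (B * Y * Bᴴ).det * X.det = Y.det := by
      rw [det_mul, det_mul, det_conjTranspose]
      linear_combination Y.det * hdetB
    rw [det_eq_ofReal_re hZ.posSemidef, det_eq_ofReal_re hX.posSemidef,
      det_eq_ofReal_re hY.posSemidef] at h1
    norm_cast at h1
    rw [logDet, logDet, logDet, ← h1, Real.log_mul (det_re_pos hZ).ne' (det_re_pos hX).ne']
    ring
  have htr : (X⁻¹ * (Y - X)).trace.re = (B * Y * Bᴴ).trace.re - m := by
    rw [Matrix.mul_sub, nonsing_inv_mul _ hXu, trace_sub, trace_one, hB, Matrix.mul_assoc,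
      trace_mul_comm]
    simp
  obtain ⟨h1, h2⟩ := logDet_le_trace_sub hZ
  rw [htr]
  refine ⟨by linarith, fun h => ?_⟩
  have hone := h2 (by linarith)
  have hinv : B * (Y * Bᴴ) = 1 := by rw [← Matrix.mul_assoc, hone]
  have h3 : Y * (Bᴴ * B) = 1 := by
    rw [← Matrix.mul_assoc]; exact mul_eq_one_comm.mp hinv
  rw [← hB] at h3
  calc Y = Y * (X⁻¹ * X) := by rw [nonsing_inv_mul _ hXu, Matrix.mul_one]
    _ = X := by rw [← Matrix.mul_assoc, h3, Matrix.one_mul]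

/-- Strict concavity of `log |·|` on positive definite matrices. -/
lemma logDet_concave {m : ℕ} {X Y : Matrix (Fin m) (Fin m) ℂ} (hX : X.PosDef) (hY : Y.PosDef)
    {a b : ℝ} (ha : 0 < a) (hb : 0 < b) (hab : a + b = 1) :
    a * logDet X + b * logDet Y ≤ logDet ((a : ℂ) • X + (b : ℂ) • Y) ∧
      (logDet ((a : ℂ) • X + (b : ℂ) • Y) ≤ a * logDet X + b * logDet Y → X = Y) := by
  set Z := (a : ℂ) • X + (b : ℂ) • Y with hZdef
  have hZ : Z.PosDef :=
    (hX.smul (by exact_mod_cast ha)).add (hY.smul (by exact_mod_cast hb))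
  obtain ⟨hx, hx'⟩ := logDet_le_add_trace hZ hX
  obtain ⟨hy, hy'⟩ := logDet_le_add_trace hZ hY
  -- Both tangent bounds are taken at the combination `Z`, so the weighted first-order terms cancel.
  have hsum : a * (Z⁻¹ * (X - Z)).trace.re + b * (Z⁻¹ * (Y - Z)).trace.re = 0 := by
    have hab' : (a : ℂ) + b = 1 := by exact_mod_cast hab
    have h0 : (a : ℂ) • (X - Z) + (b : ℂ) • (Y - Z) = 0 := by
      have : (a : ℂ) • (X - Z) + (b : ℂ) • (Y - Z) = Z - ((a : ℂ) + b) • Z := by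
        rw [hZdef]; module
      rw [this, hab', one_smul, sub_self]
    have h1 : (a : ℂ) * (Z⁻¹ * (X - Z)).trace + (b : ℂ) * (Z⁻¹ * (Y - Z)).trace = 0 := by
      have := congrArg (fun W => (Z⁻¹ * W).trace) h0
      simpa only [Matrix.mul_add, Matrix.mul_smul, trace_add, trace_smul, smul_eq_mul,
        Matrix.mul_zero, trace_zero] using this
    simpa using congrArg Complex.re h1
  have hax := mul_le_mul_of_nonneg_left hx ha.le
  have hby := mul_le_mul_of_nonneg_left hy hb.le
  obtain rfl : b = 1 - a := by linarith
  refine ⟨by linarith, fun h => ?_⟩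
  have hXZ : X = Z := hx' (le_of_mul_le_mul_left (by linarith) ha)
  have hYZ : Y = Z := hy' (le_of_mul_le_mul_left (by linarith) hb)
  rw [hXZ, hYZ]

lemma trace_mul_nonneg {m : ℕ} {A B : Matrix (Fin m) (Fin m) ℂ} (hA : A.PosSemidef)
    (hB : B.PosSemidef) : 0 ≤ (A * B).trace.re := by
  obtain ⟨C, rfl⟩ := exists_eq_conjTranspose_mul_self hA
  rw [Matrix.mul_assoc, trace_mul_comm]
  exact (Complex.le_def.mp (hB.mul_mul_conjTranspose_same C).trace_nonneg).1

/-- `log |·|` is strictly increasing along positive semidefinite directions. -/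
lemma logDet_lt_logDet_add {m : ℕ} {M X : Matrix (Fin m) (Fin m) ℂ} (hM : M.PosDef)
    (hX : X.PosSemidef) (hX0 : X ≠ 0) : logDet M < logDet (M + X) := by
  have hMX := hM.add_posSemidef hX
  -- The tangent is taken at the larger point `M + X`, where the first-order term has the needed
  -- sign.
  obtain ⟨h1, h2⟩ := logDet_le_add_trace hMX hM
  have h3 := trace_mul_nonneg hMX.inv.posSemidef hX
  have h4 : ((M + X)⁻¹ * (M - (M + X))).trace.re = -((M + X)⁻¹ * X).trace.re := by
    rw [sub_add_cancel_left, Matrix.mul_neg, trace_neg, Complex.neg_re]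
  rw [h4] at h1 h2
  refine lt_of_not_ge fun hle => hX0 ?_
  have := h2 (by linarith)
  exact left_eq_add.mp this

lemma logDet_le_logDet_add {m : ℕ} {M X : Matrix (Fin m) (Fin m) ℂ} (hM : M.PosDef)
    (hX : X.PosSemidef) : logDet M ≤ logDet (M + X) := by
  rcases eq_or_ne X 0 with rfl | h
  · simp
  · exact (logDet_lt_logDet_add hM hX h).le

lemma logDet_one {m : ℕ} : logDet (1 : Matrix (Fin m) (Fin m) ℂ) = 0 := by simp [logDet]

lemma logDet_mul_posDef {m : ℕ} {A B : Matrix (Fin m) (Fin m) ℂ} (hA : A.PosDef)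
    (hAB : (A * B).PosDef) : logDet B = logDet (A * B) - logDet A := by
  have h := det_mul A B
  rw [det_eq_ofReal_re hA.posSemidef] at h
  have hre : (A * B).det.re = A.det.re * B.det.re := by rw [h]; simp
  have hA0 := (det_re_pos hA).ne'
  have hB0 : B.det.re ≠ 0 := fun h0 => (det_re_pos hAB).ne' (by rw [hre, h0, mul_zero])
  rw [logDet, logDet, logDet, hre, Real.log_mul hA0 hB0]
  ring

/-! ### Thin singular-value decomposition. -/

lemma inner_toLp_col {m n : ℕ} (A B : Matrix (Fin m) (Fin n) ℂ) (i j : Fin n) :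
    inner ℂ (WithLp.toLp 2 (A.col i)) (WithLp.toLp 2 (B.col j)) = (Aᴴ * B) i j := by
  simp [PiLp.inner_apply, Matrix.mul_apply, mul_comm]

/-- A tall matrix with orthogonal columns is an isometry times a diagonal matrix. -/
lemma exists_isometry_mul_diagonal {m n : ℕ} (hnm : n ≤ m) {W : Matrix (Fin m) (Fin n) ℂ}
    {σ : Fin n → ℝ} (hW : Wᴴ * W = diagonal fun i => ((σ i ^ 2 : ℝ) : ℂ)) :
    ∃ U : Matrix (Fin m) (Fin n) ℂ, Uᴴ * U = 1 ∧ W = U * diagonal fun i => (σ i : ℂ) := by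
  -- Normalized columns of `W`; as `0⁻¹ = 0`, columns with `σ i = 0` become zero. These are later
  -- replaced by vectors completing the others to an orthonormal basis, for which `n ≤ m` leaves
  -- room.
  set N : Matrix (Fin m) (Fin n) ℂ := W * diagonal fun i => ((σ i : ℂ))⁻¹ with hN
  have hNN : Nᴴ * N = diagonal fun i => if σ i = 0 then 0 else 1 := by
    have : Nᴴ * N = diagonal (fun i => ((σ i : ℂ))⁻¹) * (Wᴴ * W) *
        diagonal fun i => ((σ i : ℂ))⁻¹ := by
      rw [hN, conjTranspose_mul, diagonal_conjTranspose]
      simp only [Matrix.mul_assoc]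
      congr 2
      funext i; simp
    rw [this, hW, diagonal_mul_diagonal, diagonal_mul_diagonal]
    congr 1
    funext i
    split_ifs with h
    · simp [h]
    · have : (σ i : ℂ) ≠ 0 := by exact_mod_cast h
      push_cast
      field_simp
  let v : Fin m → EuclideanSpace ℂ (Fin m) := fun k =>
    if h : (k : ℕ) < n then WithLp.toLp 2 (N.col ⟨k, h⟩) else 0
  let s : Set (Fin m) := {k | ∃ h : (k : ℕ) < n, σ ⟨k, h⟩ ≠ 0}
  have hv : Orthonormal ℂ (s.domRestrict v) := by
    rw [orthonormal_iff_ite]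
    rintro ⟨i, hi, hi0⟩ ⟨j, hj, hj0⟩
    have : inner ℂ (v i) (v j) = (Nᴴ * N) ⟨i, hi⟩ ⟨j, hj⟩ := by
      simp only [v, hi, hj, dif_pos]
      exact inner_toLp_col N N _ _
    change inner ℂ (v i) (v j) = _
    rw [this, hNN, diagonal_apply]
    simp [Fin.ext_iff, hi0]
  obtain ⟨b, hb⟩ := hv.exists_orthonormalBasis_extension_of_card_eq (by simp)
  let U : Matrix (Fin m) (Fin n) ℂ := fun k i => b (Fin.castLE hnm i) k
  have hUcol : ∀ i, WithLp.toLp 2 (U.col i) = b (Fin.castLE hnm i) := fun i => by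
    ext k; rfl
  refine ⟨U, ?_, ?_⟩
  · ext i j
    rw [← inner_toLp_col, hUcol, hUcol, orthonormal_iff_ite.mp b.orthonormal, one_apply]
    simp [Fin.ext_iff]
  · ext k i
    rw [mul_diagonal]
    by_cases h0 : σ i = 0
    · have hz : inner ℂ (WithLp.toLp 2 (W.col i)) (WithLp.toLp 2 (W.col i)) = 0 := by
        rw [inner_toLp_col, hW]; simp [h0]
      have hz' := inner_self_eq_zero.mp hz
      have := congrArg (fun x : EuclideanSpace ℂ (Fin m) => x k) hz'
      simpa [h0] using this
    · have hmem : Fin.castLE hnm i ∈ s := ⟨i.2, h0⟩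
      have hUN : U k i = N k i := by
        change b (Fin.castLE hnm i) k = _
        rw [hb _ hmem]
        simp [v]
      have : (σ i : ℂ) ≠ 0 := by exact_mod_cast h0
      rw [hUN, hN, mul_diagonal]
      field_simp

lemma exists_svd_of_le {m n : ℕ} (hnm : n ≤ m) (H : Matrix (Fin m) (Fin n) ℂ) :
    ∃ (U : Matrix (Fin m) (Fin n) ℂ) (V : Matrix (Fin n) (Fin n) ℂ) (σ : Fin n → ℝ),
      Uᴴ * U = 1 ∧ Vᴴ * V = 1 ∧ (∀ i, 0 ≤ σ i) ∧
        H = U * diagonal (fun i => (σ i : ℂ)) * Vᴴ := by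
  obtain ⟨V, e, hnn, hVV, hVV', hspec⟩ : ∃ (V : Matrix (Fin n) (Fin n) ℂ) (e : Fin n → ℝ),
      (∀ i, 0 ≤ e i) ∧ Vᴴ * V = 1 ∧ V * Vᴴ = 1 ∧
        Hᴴ * H = V * diagonal (fun i => (e i : ℂ)) * Vᴴ :=
    have hH := isHermitian_conjTranspose_mul_self H
    ⟨hH.eigenvectorUnitary.1, hH.eigenvalues, eigenvalues_conjTranspose_mul_self_nonneg H,
      Unitary.coe_star_mul_self hH.eigenvectorUnitary,
      Unitary.coe_mul_star_self hH.eigenvectorUnitary, hH.spectral_theorem⟩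
  have hW : (H * V)ᴴ * (H * V) =
      diagonal fun i => ((Real.sqrt (e i) ^ 2 : ℝ) : ℂ) := by
    have : (H * V)ᴴ * (H * V) = Vᴴ * (Hᴴ * H) * V := by
      rw [conjTranspose_mul]; simp only [Matrix.mul_assoc]
    rw [this, hspec]
    calc Vᴴ * (V * diagonal (fun i => (e i : ℂ)) * Vᴴ) * V
        = (Vᴴ * V) * diagonal (fun i => (e i : ℂ)) * (Vᴴ * V) := by
          simp only [Matrix.mul_assoc]
      _ = _ := by
          rw [hVV, Matrix.one_mul, Matrix.mul_one]
          congr 1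
          funext i
          rw [Real.sq_sqrt (hnn i)]
  obtain ⟨U, hU, hWU⟩ := exists_isometry_mul_diagonal hnm hW
  refine ⟨U, V, fun i => Real.sqrt (e i), hU, hVV, fun i => Real.sqrt_nonneg _, ?_⟩
  rw [← hWU, Matrix.mul_assoc, hVV', Matrix.mul_one]

/-- Existence of the thin singular-value decomposition. -/
lemma exists_thin_svd {m n : ℕ} (H : Matrix (Fin m) (Fin n) ℂ) :
    ∃ (U : Matrix (Fin m) (Fin (min n m)) ℂ) (V : Matrix (Fin n) (Fin (min n m)) ℂ)
      (σ : Fin (min n m) → ℝ),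
      Uᴴ * U = 1 ∧ Vᴴ * V = 1 ∧ (∀ i, 0 ≤ σ i) ∧
        H = U * diagonal (fun i => (σ i : ℂ)) * Vᴴ := by
  rcases le_total n m with h | h
  · rw [min_eq_left h]
    exact exists_svd_of_le h H
  · rw [min_eq_right h]
    obtain ⟨U, V, σ, hU, hV, hσ, hH⟩ := exists_svd_of_le h Hᴴ
    refine ⟨V, U, σ, hV, hU, hσ, ?_⟩
    rw [← conjTranspose_conjTranspose H, hH, conjTranspose_mul, conjTranspose_mul,
      diagonal_conjTranspose, conjTranspose_conjTranspose, Matrix.mul_assoc]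
    congr 3
    funext i
    simp

/-! ### Water-filling. -/

lemma waterPower_nonneg (μ σ : ℝ) : 0 ≤ waterPower μ σ := by
  unfold waterPower
  split_ifs
  · exact le_rfl
  · exact le_max_right _ _

/-- A water level meeting the power budget exists. -/
lemma exists_water_level {k : ℕ} (σ : Fin k → ℝ) {i₀ : Fin k} (hi₀ : σ i₀ ≠ 0) {P : ℝ}
    (hP : 0 ≤ P) : ∃ μ : ℝ, ∑ i, waterPower μ (σ i) = P := by
  have hcont : Continuous fun μ : ℝ => ∑ i, waterPower μ (σ i) := by
    refine continuous_finsetSum _ fun i _ => ?_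
    unfold waterPower
    split_ifs <;> fun_prop
  have h0 : ∑ i, waterPower 0 (σ i) = 0 := by
    refine Finset.sum_eq_zero fun i _ => ?_
    unfold waterPower
    split_ifs
    · rfl
    · exact max_eq_right (by have := sq_nonneg (σ i); simp; positivity)
  -- At this level mode `i₀` alone already receives power `P`.
  have hb : 0 ≤ P + 1 / σ i₀ ^ 2 := by positivity
  have h1 : P ≤ ∑ i, waterPower (P + 1 / σ i₀ ^ 2) (σ i) := by
    refine le_trans ?_ (Finset.single_le_sum (fun i _ => waterPower_nonneg _ (σ i))
      (Finset.mem_univ i₀))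
    unfold waterPower
    rw [if_neg hi₀]
    exact le_trans (by simp) (le_max_left _ _)
  obtain ⟨μ, -, hμ⟩ := intermediate_value_Icc hb hcont.continuousOn
    (show P ∈ Set.Icc _ _ from ⟨by simpa only [h0] using hP, h1⟩)
  exact ⟨μ, hμ⟩

lemma exists_isWaterFilling {m n : ℕ} {H : Matrix (Fin m) (Fin n) ℂ} (hH : H ≠ 0) {P : ℝ}
    (hP : 0 ≤ P) : ∃ S r, IsWaterFilling H P S r := by
  obtain ⟨U, V, σ, hU, hV, hσ, hdec⟩ := exists_thin_svd H
  have hne : ∃ i, σ i ≠ 0 := by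
    by_contra! h
    exact hH (by rw [hdec]; simp [h])
  obtain ⟨i₀, hi₀⟩ := hne
  obtain ⟨μ, hμ⟩ := exists_water_level σ hi₀ hP
  exact ⟨_, _, U, V, σ, μ, hU, hV, hσ, hdec, hμ, rfl, rfl⟩

/-- By cyclicity and `Q * Q = Q`, the off-diagonal blocks of `S` contribute nothing to the trace. -/
lemma trace_eq_of_projection {n : ℕ} {Q : Matrix (Fin n) (Fin n) ℂ} (hQ : Q * Q = Q)
    (S : Matrix (Fin n) (Fin n) ℂ) :
    S.trace = (Q * S * Q).trace + ((1 - Q) * S * (1 - Q)).trace := by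
  have h1 : (Q * S * Q).trace = (Q * S).trace := by
    rw [trace_mul_cycle, hQ]
  have h2 : ((1 - Q) * S * (1 - Q)).trace = ((1 - Q) * S).trace := by
    rw [trace_mul_cycle]
    congr 2
    noncomm_ring [hQ]
  rw [h1, h2, ← trace_add, ← Matrix.add_mul]
  simp

lemma trace_conj_isometry_le {n k : ℕ} {V : Matrix (Fin n) (Fin k) ℂ} (hV : Vᴴ * V = 1)
    {S : Matrix (Fin n) (Fin n) ℂ} (hS : S.PosSemidef) :
    (Vᴴ * S * V).trace.re ≤ S.trace.re := by
  have hQ : V * Vᴴ * (V * Vᴴ) = V * Vᴴ := by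
    rw [Matrix.mul_assoc, ← Matrix.mul_assoc Vᴴ, hV, Matrix.one_mul]
  have hQh : (1 - V * Vᴴ)ᴴ = 1 - V * Vᴴ := by simp
  have h1 := trace_eq_of_projection hQ S
  have h2 : (V * Vᴴ * S * (V * Vᴴ)).trace = (Vᴴ * S * V).trace := by
    rw [trace_mul_cycle, hQ, Matrix.mul_assoc, trace_mul_comm]
  have h3 := hS.conjTranspose_mul_mul_same (1 - V * Vᴴ)
  rw [hQh] at h3
  have h4 := (Complex.le_def.mp h3.trace_nonneg).1
  rw [h1, h2, Complex.add_re]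
  simpa using h4

lemma rx_posSemidef {m n : ℕ} (H : Matrix (Fin m) (Fin n) ℂ) {S : Matrix (Fin n) (Fin n) ℂ}
    (hS : S.PosSemidef) : (rx H S).PosSemidef :=
  hS.mul_mul_conjTranspose_same H

/-- Water-filling attains the capacity of the channel. -/
lemma IsWaterFilling.optimal {m n : ℕ} {H : Matrix (Fin m) (Fin n) ℂ} {P : ℝ} (hP : 0 < P)
    {S : Matrix (Fin n) (Fin n) ℂ} {r : ℝ} (h : IsWaterFilling H P S r) :
    S ∈ feasible n P ∧ r = logDet (1 + rx H S) ∧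
      IsMaxOn (fun T => logDet (1 + rx H T)) (feasible n P) S := by
  obtain ⟨U, V, σ, μ, hU, hV, hσ, rfl, hsum, rfl, rfl⟩ := h
  set p := fun i => waterPower μ (σ i) with hp
  have hp0 : ∀ i, 0 ≤ p i := fun i => waterPower_nonneg _ _
  set D : Matrix (Fin (min n m)) (Fin (min n m)) ℂ := diagonal fun i => (σ i : ℂ) with hDdef
  set Λ : Matrix (Fin (min n m)) (Fin (min n m)) ℂ := diagonal fun i => (p i : ℂ) with hΛ
  have hDH : Dᴴ = D := by
    rw [hDdef, diagonal_conjTranspose]; congr 1; funext i; simp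
  set d : Fin (min n m) → ℝ := fun i => 1 + σ i ^ 2 * p i with hd
  have hd0 : ∀ i, 0 < d i := fun i => by
    have := mul_nonneg (sq_nonneg (σ i)) (hp0 i); simp only [hd]; linarith
  have hΛp : Λ.PosSemidef := by
    rw [hΛ]
    exact PosSemidef.diagonal fun i => by simpa using hp0 i
  have hS : (V * Λ * Vᴴ).PosSemidef := hΛp.mul_mul_conjTranspose_same V
  have hrx : rx (U * D * Vᴴ) (V * Λ * Vᴴ) = U * (D * Λ * D * Uᴴ) := by
    rw [rx, conjTranspose_mul, conjTranspose_mul, conjTranspose_conjTranspose, hDH]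
    calc _ = U * D * (Vᴴ * V) * Λ * (Vᴴ * V) * D * Uᴴ := by simp only [Matrix.mul_assoc]
      _ = _ := by rw [hV]; simp only [Matrix.mul_assoc, Matrix.one_mul]
  have hΔ : 1 + D * Λ * D = diagonal fun i => (d i : ℂ) := by
    rw [hDdef, hΛ, diagonal_mul_diagonal, diagonal_mul_diagonal, ← diagonal_one, diagonal_add]
    congr 1; funext i; simp only [hd]; push_cast; ring
  refine ⟨⟨hS, ?_⟩, ?_, ?_⟩
  · rw [Matrix.mul_assoc, trace_mul_comm, Matrix.mul_assoc, hV, Matrix.mul_one, hΛ,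
      trace_diagonal, ← hsum, Complex.re_sum]
    simp [hp]
  · rw [logDet, hrx, det_one_add_mul_comm, Matrix.mul_assoc, hU, Matrix.mul_one, hΔ,
      det_diagonal, ← Complex.ofReal_prod, Complex.ofReal_re,
      Real.log_prod (fun i _ => (hd0 i).ne')]
  · rintro T ⟨hT, hTP⟩
    -- A nonpositive water level would allot no power at all.
    have hμ : 0 < μ := by
      by_contra! hμ
      have : ∑ i, p i = 0 := Finset.sum_eq_zero fun i _ => by
        simp only [hp, waterPower]
        split_ifs
        · rfl
        · exact max_eq_right (by have : 0 ≤ 1 / σ i ^ 2 := by positivity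
                                 linarith)
      simp only [hp] at this
      linarith
    set M := 1 + rx (U * D * Vᴴ) (V * Λ * Vᴴ) with hM
    have hMp : M.PosDef := PosDef.one.add_posSemidef (rx_posSemidef _ hS)
    have hMT : (1 + rx (U * D * Vᴴ) T).PosDef := PosDef.one.add_posSemidef (rx_posSemidef _ hT)
    have hMu : IsUnit M.det := (Matrix.isUnit_iff_isUnit_det _).mp hMp.isUnit
    have hMU : M * U = U * diagonal fun i => (d i : ℂ) := by
      rw [hM, hrx, ← hΔ, Matrix.add_mul, Matrix.mul_add, Matrix.one_mul, Matrix.mul_one]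
      simp only [Matrix.mul_assoc]
      rw [hU, Matrix.mul_one]
    have hMiU : M⁻¹ * U = U * diagonal fun i => ((d i)⁻¹ : ℂ) := by
      have h1 : U = M * (U * diagonal fun i => ((d i)⁻¹ : ℂ)) := by
        rw [← Matrix.mul_assoc, hMU, Matrix.mul_assoc, diagonal_mul_diagonal]
        have : (fun i => (d i : ℂ) * (d i : ℂ)⁻¹) = fun _ => 1 := by
          funext i
          exact mul_inv_cancel₀ (by exact_mod_cast (hd0 i).ne')
        rw [this, diagonal_one, Matrix.mul_one]
      conv_lhs => rw [h1]
      rw [← Matrix.mul_assoc, nonsing_inv_mul _ hMu, Matrix.one_mul]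
    -- the gradient of the rate is `V diag(g) Vᴴ`
    set g : Fin (min n m) → ℝ := fun i => σ i ^ 2 * (d i)⁻¹ with hg
    have hgrad : ∀ X : Matrix (Fin n) (Fin n) ℂ, (M⁻¹ * rx (U * D * Vᴴ) X).trace.re =
        ∑ i, g i * ((Vᴴ * X * V) i i).re := by
      intro X
      have h1 : (M⁻¹ * rx (U * D * Vᴴ) X).trace =
          (diagonal (fun i => (g i : ℂ)) * (Vᴴ * X * V)).trace := by
        have h2 : M⁻¹ * rx (U * D * Vᴴ) X = (M⁻¹ * U * D * (Vᴴ * X * V)) * (D * Uᴴ) := by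
          rw [rx, conjTranspose_mul, conjTranspose_mul, conjTranspose_conjTranspose, hDH]
          simp only [Matrix.mul_assoc]
        rw [h2, hMiU, trace_mul_comm]
        have h3 : (D * Uᴴ) * (U * (diagonal fun i => ((d i)⁻¹ : ℂ)) * D * (Vᴴ * X * V)) =
            (D * ((Uᴴ * U) * ((diagonal fun i => ((d i)⁻¹ : ℂ)) * D))) * (Vᴴ * X * V) := by
          simp only [Matrix.mul_assoc]
        rw [h3, hU, Matrix.one_mul, hDdef, diagonal_mul_diagonal, diagonal_mul_diagonal]
        congr 3
        funext i
        simp only [hg]; push_cast; ring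
      rw [h1, trace, Complex.re_sum]
      refine Finset.sum_congr rfl fun i _ => ?_
      rw [diag_apply, diagonal_mul, Complex.re_ofReal_mul]
    -- The KKT conditions: the marginal rate equals `μ⁻¹` on active modes and is at most `μ⁻¹` on
    -- the others. With the tangent bound at `M` they certify global optimality.
    have hgle : ∀ i, g i ≤ μ⁻¹ ∧ (p i ≠ 0 → g i = μ⁻¹) := by
      intro i
      simp only [hg, hd, hp, waterPower]
      by_cases h0 : σ i = 0
      · simp [h0, hμ.le]
      · have hs : 0 < σ i ^ 2 := by positivity
        rw [if_neg h0]
        rcases le_total (μ - 1 / σ i ^ 2) 0 with hle | hle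
        · rw [max_eq_right hle]
          refine ⟨?_, fun h => absurd rfl h⟩
          simp only [mul_zero, add_zero, inv_one, mul_one]
          rw [le_inv_comm₀ hs hμ, ← one_div]
          linarith
        · rw [max_eq_left hle]
          have : σ i ^ 2 * (1 + σ i ^ 2 * (μ - 1 / σ i ^ 2))⁻¹ = μ⁻¹ := by
            have : 1 + σ i ^ 2 * (μ - 1 / σ i ^ 2) = σ i ^ 2 * μ := by field_simp; ring
            rw [this]; field_simp
          exact ⟨this.le, fun _ => this⟩
    have hVSV : Vᴴ * (V * Λ * Vᴴ) * V = Λ := by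
      calc Vᴴ * (V * Λ * Vᴴ) * V = (Vᴴ * V) * Λ * (Vᴴ * V) := by simp only [Matrix.mul_assoc]
        _ = Λ := by rw [hV, Matrix.one_mul, Matrix.mul_one]
    have hgS : ∑ i, g i * ((Vᴴ * (V * Λ * Vᴴ) * V) i i).re = μ⁻¹ * P := by
      rw [hVSV, ← hsum, Finset.mul_sum]
      refine Finset.sum_congr rfl fun i _ => ?_
      rw [hΛ, diagonal_apply_eq, Complex.ofReal_re]
      by_cases h0 : p i = 0
      · change g i * p i = μ⁻¹ * p i
        rw [h0, mul_zero, mul_zero]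
      · rw [(hgle i).2 h0]
    have hgT : ∑ i, g i * ((Vᴴ * T * V) i i).re ≤ μ⁻¹ * P := by
      have hVT := hT.conjTranspose_mul_mul_same V
      calc ∑ i, g i * ((Vᴴ * T * V) i i).re ≤ ∑ i, μ⁻¹ * ((Vᴴ * T * V) i i).re := by
            refine Finset.sum_le_sum fun i _ => mul_le_mul_of_nonneg_right (hgle i).1 ?_
            exact (Complex.le_def.mp hVT.diag_nonneg).1
        _ = μ⁻¹ * (Vᴴ * T * V).trace.re := by
            rw [← Finset.mul_sum, trace, Complex.re_sum]; rfl
        _ ≤ μ⁻¹ * P := by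
            refine mul_le_mul_of_nonneg_left ?_ (inv_nonneg.mpr hμ.le)
            exact (trace_conj_isometry_le hV hT).trans hTP
    have hfo := (logDet_le_add_trace hMp hMT).1
    have hsub : (M⁻¹ * (1 + rx (U * D * Vᴴ) T - M)).trace.re =
        (M⁻¹ * rx (U * D * Vᴴ) T).trace.re -
          (M⁻¹ * rx (U * D * Vᴴ) (V * Λ * Vᴴ)).trace.re := by
      have : 1 + rx (U * D * Vᴴ) T - M =
          rx (U * D * Vᴴ) T - rx (U * D * Vᴴ) (V * Λ * Vᴴ) := by rw [hM]; abel
      rw [this, Matrix.mul_sub, trace_sub, Complex.sub_re]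
    rw [hsub, hgrad, hgrad, hgS] at hfo
    change logDet _ ≤ logDet M
    linarith

/-! ### Concavity of the rates and compactness of the constraint set. -/

lemma rx_add {m n : ℕ} (H : Matrix (Fin m) (Fin n) ℂ) (S T : Matrix (Fin n) (Fin n) ℂ) :
    rx H (S + T) = rx H S + rx H T := by
  simp only [rx, Matrix.mul_add, Matrix.add_mul]

lemma rx_smul {m n : ℕ} (H : Matrix (Fin m) (Fin n) ℂ) (a : ℝ) (S : Matrix (Fin n) (Fin n) ℂ) :
    rx H (a • S) = a • rx H S := by
  simp only [rx, Matrix.mul_smul, Matrix.smul_mul]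

lemma posDef_add_rx {m n : ℕ} {M : Matrix (Fin m) (Fin m) ℂ} (hM : M.PosDef)
    (H : Matrix (Fin m) (Fin n) ℂ) {S : Matrix (Fin n) (Fin n) ℂ} (hS : S.PosSemidef) :
    (M + rx H S).PosDef :=
  hM.add_posSemidef (rx_posSemidef H hS)

lemma posDef_one_add_rx {m n : ℕ} (H : Matrix (Fin m) (Fin n) ℂ)
    {S : Matrix (Fin n) (Fin n) ℂ} (hS : S.PosSemidef) : (1 + rx H S).PosDef :=
  posDef_add_rx PosDef.one H hS

lemma posSemidef_real_smul {n : ℕ} {S : Matrix (Fin n) (Fin n) ℂ} (hS : S.PosSemidef) {a : ℝ}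
    (ha : 0 ≤ a) : (a • S).PosSemidef := by
  have : a • S = (a : ℂ) • S := by ext; simp
  rw [this]
  exact hS.smul (by exact_mod_cast ha)

/-- The rate `log |M + H S Hᴴ|` is concave in `S`, strictly so in the received covariance. -/
lemma rate_concave {m n : ℕ} {M : Matrix (Fin m) (Fin m) ℂ} (hM : M.PosDef)
    (H : Matrix (Fin m) (Fin n) ℂ) {S T : Matrix (Fin n) (Fin n) ℂ} (hS : S.PosSemidef)
    (hT : T.PosSemidef) {a b : ℝ} (ha : 0 < a) (hb : 0 < b) (hab : a + b = 1) :
    a * logDet (M + rx H S) + b * logDet (M + rx H T) ≤ logDet (M + rx H (a • S + b • T)) ∧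
      (logDet (M + rx H (a • S + b • T)) ≤
        a * logDet (M + rx H S) + b * logDet (M + rx H T) → rx H S = rx H T) := by
  have h := logDet_concave (posDef_add_rx hM H hS) (posDef_add_rx hM H hT) ha hb hab
  have heq : (a : ℂ) • (M + rx H S) + (b : ℂ) • (M + rx H T) = M + rx H (a • S + b • T) := by
    have hab' : (a : ℂ) + b = 1 := by exact_mod_cast hab
    rw [rx_add, rx_smul, rx_smul]
    ext i j
    simp only [Matrix.add_apply, Matrix.smul_apply, smul_eq_mul, Complex.real_smul]
    linear_combination M i j * hab'
  rw [heq] at h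
  exact ⟨h.1, fun hle => add_left_cancel (h.2 hle)⟩

lemma convex_feasible (n : ℕ) (P : ℝ) : Convex ℝ (feasible n P) := by
  rw [convex_iff_forall_pos]
  rintro S ⟨hS, hSP⟩ T ⟨hT, hTP⟩ a b ha hb hab
  refine ⟨(posSemidef_real_smul hS ha.le).add (posSemidef_real_smul hT hb.le), ?_⟩
  rw [trace_add, trace_smul, trace_smul, Complex.add_re, Complex.smul_re, Complex.smul_re,
    smul_eq_mul, smul_eq_mul]
  calc a * S.trace.re + b * T.trace.re ≤ a * P + b * P := by gcongr
    _ = P := by rw [← add_mul, hab, one_mul]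

lemma concaveOn_rate {m n : ℕ} {M : Matrix (Fin m) (Fin m) ℂ} (hM : M.PosDef)
    (H : Matrix (Fin m) (Fin n) ℂ) (P : ℝ) :
    ConcaveOn ℝ (feasible n P) fun S => logDet (M + rx H S) := by
  rw [concaveOn_iff_forall_pos]
  exact ⟨convex_feasible n P, fun S hS T hT a b ha hb hab =>
    (rate_concave hM H hS.1 hT.1 ha hb hab).1⟩

/-- The set is the image under `L ↦ Lᴴ L` of a closed Frobenius ball, since `tr (Lᴴ L)` is the sum
of the squared entries. -/
lemma isCompact_feasible (n : ℕ) (P : ℝ) : IsCompact (feasible n P) := by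
  let K : Set (Matrix (Fin n) (Fin n) ℂ) := {L | (Lᴴ * L).trace.re ≤ P}
  have hcont : Continuous fun L : Matrix (Fin n) (Fin n) ℂ => Lᴴ * L := by fun_prop
  have hcl : IsClosed K :=
    isClosed_le (Complex.continuous_re.comp hcont.matrix_trace) continuous_const
  have htr : ∀ L : Matrix (Fin n) (Fin n) ℂ, (Lᴴ * L).trace.re = ∑ j, ∑ i, ‖L i j‖ ^ 2 := by
    intro L
    simp only [trace, diag_apply, Matrix.mul_apply, conjTranspose_apply, Complex.re_sum]
    refine Finset.sum_congr rfl fun j _ => Finset.sum_congr rfl fun i _ => ?_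
    rw [Complex.star_def, ← Complex.normSq_eq_conj_mul_self, Complex.ofReal_re,
      Complex.normSq_eq_norm_sq]
  have hK : IsCompact K := by
    refine IsCompact.of_isClosed_subset
      (isCompact_univ_pi fun _ : Fin n => isCompact_univ_pi fun _ : Fin n =>
        isCompact_closedBall (0 : ℂ) (Real.sqrt P)) hcl ?_
    intro L hL i _ j _
    rw [mem_closedBall_zero_iff]
    refine Real.le_sqrt_of_sq_le (le_trans ?_ hL)
    rw [htr]
    refine le_trans ?_ (Finset.single_le_sum (f := fun j => ∑ i, ‖L i j‖ ^ 2)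
      (fun j _ => by positivity) (Finset.mem_univ j))
    exact Finset.single_le_sum (f := fun i => ‖L i j‖ ^ 2) (fun i _ => by positivity)
      (Finset.mem_univ i)
  have himg : feasible n P = (fun L : Matrix (Fin n) (Fin n) ℂ => Lᴴ * L) '' K := by
    ext S
    constructor
    · rintro ⟨hS, hSP⟩
      obtain ⟨L, rfl⟩ := exists_eq_conjTranspose_mul_self hS
      exact ⟨L, hSP, rfl⟩
    · rintro ⟨L, hL, rfl⟩
      exact ⟨posSemidef_conjTranspose_mul_self L, hL⟩
  rw [himg]
  exact hK.image hcont

lemma continuousOn_rate {m n : ℕ} {M : Matrix (Fin m) (Fin m) ℂ} (hM : M.PosDef)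
    (H : Matrix (Fin m) (Fin n) ℂ) (P : ℝ) :
    ContinuousOn (fun S => logDet (M + rx H S)) (feasible n P) := by
  have hdet : Continuous fun S : Matrix (Fin n) (Fin n) ℂ => (M + rx H S).det.re := by
    refine Complex.continuous_re.comp (Continuous.matrix_det ?_)
    unfold rx
    fun_prop
  exact hdet.continuousOn.log fun S hS => (det_re_pos (posDef_add_rx hM H hS.1)).ne'

lemma nonempty_feasible (n : ℕ) {P : ℝ} (hP : 0 ≤ P) : (feasible n P).Nonempty :=
  ⟨0, PosSemidef.zero, by simpa using hP⟩

/-! ### Uniqueness of maximizers of weighted rates. -/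

/-- The orthogonal projection onto the orthogonal complement of the kernel of `H`. -/
lemma exists_support_projection {m n : ℕ} (H : Matrix (Fin m) (Fin n) ℂ) :
    ∃ (Q : Matrix (Fin n) (Fin n) ℂ) (K : Matrix (Fin n) (Fin m) ℂ),
      Qᴴ = Q ∧ Q * Q = Q ∧ H * Q = H ∧ K * H = Q := by
  obtain ⟨U, V, σ, hU, hV, -, hH⟩ := exists_thin_svd H
  set e : Fin (min n m) → ℂ := fun i => if σ i = 0 then 0 else 1 with he
  -- The second witness is the Moore–Penrose pseudoinverse; the convention `0⁻¹ = 0` handles zero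
  -- singular values.
  refine ⟨V * diagonal e * Vᴴ, V * diagonal (fun i => (σ i : ℂ)⁻¹) * Uᴴ, ?_, ?_, ?_, ?_⟩
  · rw [conjTranspose_mul, conjTranspose_mul, conjTranspose_conjTranspose, diagonal_conjTranspose,
      Matrix.mul_assoc]
    congr 3
    funext i
    simp only [he, Pi.star_apply]
    split_ifs <;> simp
  · calc _ = V * (diagonal e * (Vᴴ * V) * diagonal e) * Vᴴ := by simp only [Matrix.mul_assoc]
      _ = _ := by
        rw [hV, Matrix.mul_one, diagonal_mul_diagonal]
        congr 3
        funext i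
        simp [he]
  · rw [hH]
    calc _ = U * (diagonal (fun i => (σ i : ℂ)) * (Vᴴ * V) * diagonal e) * Vᴴ := by
          simp only [Matrix.mul_assoc]
      _ = _ := by
        rw [hV, Matrix.mul_one, diagonal_mul_diagonal]
        congr 3
        funext i
        by_cases h : σ i = 0 <;> simp [he, h]
  · rw [hH]
    calc _ = V * (diagonal (fun i => (σ i : ℂ)⁻¹) * (Uᴴ * U) * diagonal fun i => (σ i : ℂ)) *
            Vᴴ := by
          simp only [Matrix.mul_assoc]
      _ = _ := by
        rw [hU, Matrix.mul_one, diagonal_mul_diagonal]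
        congr 3
        funext i
        by_cases h : σ i = 0 <;> simp [he, h]

/-- Writing `S = Cᴴ C`, the trace bound leaves no room for `C (1 - Q)`, so `C = C Q`. -/
lemma eq_conj_projection_of_trace_le {n : ℕ} {Q S : Matrix (Fin n) (Fin n) ℂ} (hQh : Qᴴ = Q)
    (hQ : Q * Q = Q) (hS : S.PosSemidef) (htr : S.trace.re ≤ (Q * S * Q).trace.re) :
    Q * S * Q = S := by
  obtain ⟨C, rfl⟩ := exists_eq_conjTranspose_mul_self hS
  have hQh' : (1 - Q)ᴴ = 1 - Q := by simp [hQh]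
  have h1 := trace_eq_of_projection hQ (Cᴴ * C)
  have h2 : (1 - Q) * (Cᴴ * C) * (1 - Q) = (C * (1 - Q))ᴴ * (C * (1 - Q)) := by
    rw [conjTranspose_mul, hQh']; simp only [Matrix.mul_assoc]
  have h3 := (posSemidef_conjTranspose_mul_self (C * (1 - Q))).trace_nonneg
  rw [← h2, Complex.le_def] at h3
  have h4 : ((1 - Q) * (Cᴴ * C) * (1 - Q)).trace = 0 := by
    refine Complex.ext (le_antisymm ?_ h3.1) h3.2.symm
    have := congrArg Complex.re h1
    rw [Complex.add_re] at this
    simp only [Complex.zero_re]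
    linarith
  rw [h2, trace_conjTranspose_mul_self_eq_zero_iff, Matrix.mul_sub, Matrix.mul_one,
    sub_eq_zero] at h4
  have h5 : Q * Cᴴ = Cᴴ := by
    have := congrArg conjTranspose h4
    rwa [conjTranspose_mul, hQh, eq_comm] at this
  rw [← Matrix.mul_assoc, h5, Matrix.mul_assoc, ← h4]

lemma rx_one_ne_zero {m n : ℕ} {H : Matrix (Fin m) (Fin n) ℂ} (hH : H ≠ 0) {ε : ℝ}
    (hε : 0 < ε) : rx H (ε • 1) ≠ 0 := by
  rw [rx_smul, rx, Matrix.mul_one]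
  exact smul_ne_zero hε.ne' fun h => hH (self_mul_conjTranspose_eq_zero.mp h)

/-- A maximizer of a weighted sum of rates is supported on the complement of the kernel. -/
lemma weighted_rate_maximizer_support {m n : ℕ} {M₁ M₂ : Matrix (Fin m) (Fin m) ℂ}
    (hM₁ : M₁.PosDef) (hM₂ : M₂.PosDef) {H : Matrix (Fin m) (Fin n) ℂ} (hH : H ≠ 0)
    {P α β : ℝ} (hα : 0 ≤ α) (hβ : 0 ≤ β) (hαβ : 0 < α + β)
    {S : Matrix (Fin n) (Fin n) ℂ} (hS : S ∈ feasible n P)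
    (hmax : IsMaxOn (fun T => α * logDet (M₁ + rx H T) + β * logDet (M₂ + rx H T))
      (feasible n P) S)
    {Q : Matrix (Fin n) (Fin n) ℂ} (hQh : Qᴴ = Q) (hQ : Q * Q = Q) (hHQ : H * Q = H) :
    Q * S * Q = S := by
  have hn : 0 < n := by
    rcases Nat.eq_zero_or_pos n with rfl | h
    · exact absurd (Matrix.ext fun i j => j.elim0) hH
    · exact h
  have hn' : (0 : ℝ) < n := by exact_mod_cast hn
  have hT : (Q * S * Q).PosSemidef := by
    have := hS.1.mul_mul_conjTranspose_same Q
    rwa [hQh] at this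
  have hrx : rx H (Q * S * Q) = rx H S := by
    have : rx H (Q * S * Q) = (H * Q) * S * (H * Q)ᴴ := by
      rw [rx, conjTranspose_mul, hQh]; simp only [Matrix.mul_assoc]
    rw [this, hHQ, rx]
  refine eq_conj_projection_of_trace_le hQh hQ hS.1 (hS.2.trans ?_)
  by_contra! hlt
  -- Projecting keeps the received covariance. Power saved by it, spread evenly as `ε • 1`, would
  -- strictly raise both rates; dividing by `n` brings the trace to exactly `P`.
  set ε : ℝ := (P - (Q * S * Q).trace.re) / n with hε
  have hε0 : 0 < ε := div_pos (sub_pos.mpr hlt) hn'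
  have hI : ((ε • 1 : Matrix (Fin n) (Fin n) ℂ)).PosSemidef :=
    posSemidef_real_smul PosSemidef.one hε0.le
  have hfeas : Q * S * Q + ε • 1 ∈ feasible n P := by
    refine ⟨hT.add hI, ?_⟩
    rw [trace_add, trace_smul, trace_one, Complex.add_re, Complex.smul_re, Fintype.card_fin,
      Complex.natCast_re, smul_eq_mul, hε, div_mul_cancel₀ _ hn'.ne']
    linarith
  have hle := hmax hfeas
  have h1 := logDet_lt_logDet_add (posDef_add_rx hM₁ H hS.1) (rx_posSemidef H hI)
    (rx_one_ne_zero hH hε0)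
  have h2 := logDet_lt_logDet_add (posDef_add_rx hM₂ H hS.1) (rx_posSemidef H hI)
    (rx_one_ne_zero hH hε0)
  simp only [Set.mem_ofPred_eq, rx_add, hrx, ← add_assoc] at hle
  rcases hα.eq_or_lt with rfl | hα'
  · have hβ' : 0 < β := by linarith
    have := mul_lt_mul_of_pos_left h2 hβ'
    linarith
  · have := mul_lt_mul_of_pos_left h1 hα'
    have := mul_le_mul_of_nonneg_left h2.le hβ
    linarith

/-- A weighted sum of rates has at most one maximizer. -/
lemma weighted_rate_maximizer_unique {m n : ℕ} {M₁ M₂ : Matrix (Fin m) (Fin m) ℂ}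
    (hM₁ : M₁.PosDef) (hM₂ : M₂.PosDef) {H : Matrix (Fin m) (Fin n) ℂ} (hH : H ≠ 0)
    {P α β : ℝ} (hα : 0 ≤ α) (hβ : 0 ≤ β) (hαβ : 0 < α + β)
    {S T : Matrix (Fin n) (Fin n) ℂ} (hS : S ∈ feasible n P) (hT : T ∈ feasible n P)
    (hSmax : IsMaxOn (fun T => α * logDet (M₁ + rx H T) + β * logDet (M₂ + rx H T))
      (feasible n P) S)
    (hTmax : IsMaxOn (fun T => α * logDet (M₁ + rx H T) + β * logDet (M₂ + rx H T))
      (feasible n P) T) : S = T := by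
  have half : (0 : ℝ) < 1 / 2 := by norm_num
  have hmid := convex_feasible n P hS hT half.le half.le (by norm_num)
  have hST := hSmax hT
  have hTS := hTmax hS
  have hmS := hSmax hmid
  simp only [Set.mem_ofPred_eq] at hST hTS hmS
  obtain ⟨c1, e1⟩ := rate_concave hM₁ H hS.1 hT.1 half half (by norm_num)
  obtain ⟨c2, e2⟩ := rate_concave hM₂ H hS.1 hT.1 half half (by norm_num)
  have hrx : rx H S = rx H T := by
    rcases hα.eq_or_lt with rfl | hα'
    · have hβ' : 0 < β := by linarith
      exact e2 (le_of_mul_le_mul_left (by linarith) hβ')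
    · have := mul_le_mul_of_nonneg_left c2 hβ
      exact e1 (le_of_mul_le_mul_left (by linarith) hα')
  obtain ⟨Q, K, hQh, hQ, hHQ, hKH⟩ := exists_support_projection H
  -- The compression by `Q` depends on `X` only through the received covariance, so equal received
  -- covariances suffice.
  have key : ∀ X : Matrix (Fin n) (Fin n) ℂ, Q * X * Q = K * rx H X * Kᴴ := by
    intro X
    nth_rewrite 2 [← hQh]
    rw [← hKH, conjTranspose_mul, rx]
    simp only [Matrix.mul_assoc]
  rw [← weighted_rate_maximizer_support hM₁ hM₂ hH hα hβ hαβ hS hSmax hQh hQ hHQ,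
    ← weighted_rate_maximizer_support hM₁ hM₂ hH hα hβ hαβ hT hTmax hQh hQ hHQ, key, key, hrx]

/-! ### Minimax for two concave functions. -/

/-- Two-function minimax: if `min f g ≤ v` on a convex set, for concave `f` and `g`, then some
convex combination of `f` and `g` is at most `v`. -/
lemma exists_convex_combination_le {E : Type*} [AddCommGroup E] [Module ℝ E] {s : Set E}
    (hs : s.Nonempty) {f g : E → ℝ} (hf : ConcaveOn ℝ s f) (hg : ConcaveOn ℝ s g) {v : ℝ}
    (hv : ∀ x ∈ s, min (f x) (g x) ≤ v) :
    ∃ a : ℝ, 0 ≤ a ∧ a ≤ 1 ∧ ∀ x ∈ s, a * f x + (1 - a) * g x ≤ v := by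
  let C : Set (ℝ × ℝ) := {z | ∃ x ∈ s, z.1 ≤ f x ∧ z.2 ≤ g x}
  let D : Set (ℝ × ℝ) := Set.Ioi v ×ˢ Set.Ioi v
  have hC : Convex ℝ C := by
    rintro z ⟨x, hx, hx1, hx2⟩ w ⟨y, hy, hy1, hy2⟩ a b ha hb hab
    refine ⟨a • x + b • y, hf.1 hx hy ha hb hab, ?_, ?_⟩
    · refine le_trans ?_ (hf.2 hx hy ha hb hab)
      simp only [Prod.fst_add, Prod.smul_fst, smul_eq_mul]
      gcongr
    · refine le_trans ?_ (hg.2 hx hy ha hb hab)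
      simp only [Prod.snd_add, Prod.smul_snd, smul_eq_mul]
      gcongr
  have hD : Convex ℝ D := (convex_Ioi v).prod (convex_Ioi v)
  have hdisj : Disjoint D C := by
    rw [Set.disjoint_left]
    rintro z ⟨hz1, hz2⟩ ⟨x, hx, hx1, hx2⟩
    have h1 : v < f x := lt_of_lt_of_le hz1 hx1
    have h2 : v < g x := lt_of_lt_of_le hz2 hx2
    exact absurd (hv x hx) (not_le.mpr (lt_min h1 h2))
  -- Separates the open quadrant above `(v, v)` from the downward closure of the image of `(f, g)`.
  obtain ⟨φ, u, hφD, hφC⟩ := geometric_hahn_banach_open hD (isOpen_Ioi.prod isOpen_Ioi) hC hdisj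
  set p := φ (1, 0) with hp
  set q := φ (0, 1) with hq
  have hφ : ∀ a b : ℝ, φ (a, b) = a * p + b * q := by
    intro a b
    have : ((a, b) : ℝ × ℝ) = a • (1, 0) + b • (0, 1) := by simp
    rw [this, map_add, map_smul, map_smul, smul_eq_mul, smul_eq_mul]
  have hDlt : ∀ a b : ℝ, 0 < a → 0 < b → (v + a) * p + (v + b) * q < u := by
    intro a b ha hb
    rw [← hφ]
    exact hφD _ ⟨by simpa using ha, by simpa using hb⟩
  have hcl : v * p + v * q ≤ u := by
    by_contra! hlt
    have hcont : Filter.Tendsto (fun t : ℝ => (v + t) * p + (v + t) * q)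
        (nhdsWithin 0 (Set.Ioi 0)) (nhds ((v + 0) * p + (v + 0) * q)) :=
      (Continuous.tendsto (by fun_prop) 0).mono_left nhdsWithin_le_nhds
    rw [add_zero] at hcont
    refine absurd (le_of_tendsto hcont ?_) (not_le.mpr hlt)
    filter_upwards [self_mem_nhdsWithin] with t ht
    exact (hDlt t t ht ht).le
  obtain ⟨x₀, hx₀⟩ := hs
  have hCle : ∀ x ∈ s, ∀ a b : ℝ, 0 ≤ a → 0 ≤ b → u ≤ (f x - a) * p + (g x - b) * q := by
    intro x hx a b ha hb
    rw [← hφ]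
    exact hφC _ ⟨x, hx, by simpa using ha, by simpa using hb⟩
  -- The set `C` is unbounded downward in each coordinate, so a positive coefficient would push `φ`
  -- below `u`; the shift used exceeds what is needed by one.
  have hp0 : p ≤ 0 := by
    by_contra! hpos
    have h1 := hCle x₀ hx₀ ((|f x₀ * p + g x₀ * q - u| + 1) / p) 0 (by positivity) le_rfl
    rw [sub_mul, div_mul_cancel₀ _ hpos.ne'] at h1
    have := le_abs_self (f x₀ * p + g x₀ * q - u)
    linarith
  have hq0 : q ≤ 0 := by
    by_contra! hpos
    have h1 := hCle x₀ hx₀ 0 ((|f x₀ * p + g x₀ * q - u| + 1) / q) le_rfl (by positivity)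
    rw [sub_mul (g x₀), div_mul_cancel₀ _ hpos.ne'] at h1
    have := le_abs_self (f x₀ * p + g x₀ * q - u)
    linarith
  have hpq : p + q < 0 := by
    refine lt_of_le_of_ne (by linarith) fun h0 => ?_
    have hp' : p = 0 := by linarith
    have hq' : q = 0 := by linarith
    have h1 := hDlt 1 1 one_pos one_pos
    have h2 := hCle x₀ hx₀ 0 0 le_rfl le_rfl
    rw [hp', hq'] at h1 h2
    linarith
  refine ⟨p / (p + q), div_nonneg_of_nonpos hp0 hpq.le, ?_, fun x hx => ?_⟩
  · rw [div_le_one_of_neg hpq]; linarith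
  · have h1 := hCle x hx 0 0 le_rfl le_rfl
    have h2 : p / (p + q) * f x + (1 - p / (p + q)) * g x = (f x * p + g x * q) / (p + q) := by
      field_simp [hpq.ne]
      ring
    rw [h2, div_le_iff_of_neg hpq]
    linarith

/-! ### Rate identities, opportunistic rate and Lagrangian duality. -/

section

variable {m n₁ n₂ : ℕ} {H₁₁ : Matrix (Fin m) (Fin n₁) ℂ} {H₂₁ : Matrix (Fin m) (Fin n₂) ℂ}
  {S₂ : Matrix (Fin n₂) (Fin n₂) ℂ} {S : Matrix (Fin n₁) (Fin n₁) ℂ}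

lemma sumRate_eq_logDet (H₁₁ : Matrix (Fin m) (Fin n₁) ℂ) (H₂₁ : Matrix (Fin m) (Fin n₂) ℂ)
    (S₂ : Matrix (Fin n₂) (Fin n₂) ℂ) (S : Matrix (Fin n₁) (Fin n₁) ℂ) :
    sumRate H₁₁ H₂₁ S₂ S = logDet ((1 + rx H₂₁ S₂) + rx H₁₁ S) := by
  rw [sumRate, add_right_comm]

lemma Ra_eq (H₁₁ : Matrix (Fin m) (Fin n₁) ℂ) (H₂₁ : Matrix (Fin m) (Fin n₂) ℂ)
    (hS₂ : S₂.PosSemidef) (hS : S.PosSemidef) :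
    Ra H₁₁ H₂₁ S₂ S = sumRate H₁₁ H₂₁ S₂ S - ownRate H₁₁ S := by
  have hA := posDef_one_add_rx H₁₁ hS
  have hAB := posDef_add_rx hA H₂₁ hS₂
  have hmul : (1 + rx H₁₁ S) * (1 + (1 + rx H₁₁ S)⁻¹ * rx H₂₁ S₂) =
      1 + rx H₁₁ S + rx H₂₁ S₂ := by
    rw [Matrix.mul_add, Matrix.mul_one, ← Matrix.mul_assoc,
      mul_nonsing_inv _ ((Matrix.isUnit_iff_isUnit_det _).mp hA.isUnit), Matrix.one_mul]
  rw [← hmul] at hAB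
  rw [Ra, logDet_mul_posDef hA hAB, hmul, sumRate, ownRate]

lemma noiseRate_eq (H₁₁ : Matrix (Fin m) (Fin n₁) ℂ) (H₂₁ : Matrix (Fin m) (Fin n₂) ℂ)
    (hS₂ : S₂.PosSemidef) (hS : S.PosSemidef) :
    noiseRate H₁₁ H₂₁ S₂ S = sumRate H₁₁ H₂₁ S₂ S - Rb H₂₁ S₂ := by
  have h := Ra_eq H₂₁ H₁₁ hS hS₂
  rw [noiseRate, Rb]
  rw [Ra, ownRate, sumRate, add_right_comm] at h
  exact h

/-- Conjugating `X + X²` by `(1 + X)⁻¹` gives exactly this matrix. -/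
lemma posSemidef_one_sub_inv {X : Matrix (Fin m) (Fin m) ℂ} (hX : X.PosSemidef) :
    (1 - (1 + X)⁻¹).PosSemidef := by
  have hM : (1 + X).PosDef := PosDef.one.add_posSemidef hX
  have hu : IsUnit (1 + X).det := (Matrix.isUnit_iff_isUnit_det _).mp hM.isUnit
  have hpsd : (X + Xᴴ * X).PosSemidef := hX.add (posSemidef_conjTranspose_mul_self X)
  have h := hpsd.mul_mul_conjTranspose_same (1 + X)⁻¹
  have heq : (1 + X)⁻¹ * (X + Xᴴ * X) * ((1 + X)⁻¹)ᴴ = 1 - (1 + X)⁻¹ := by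
    rw [hM.inv.1, hX.1]
    have h1 : X + X * X = (1 + X) * ((1 + X) - 1) := by noncomm_ring
    rw [h1, ← Matrix.mul_assoc, nonsing_inv_mul _ hu, Matrix.one_mul, Matrix.sub_mul,
      mul_nonsing_inv _ hu, Matrix.one_mul]
  rwa [heq] at h

/-- A signal received in less noise has the higher rate. -/
lemma Ra_le_Rb (H₁₁ : Matrix (Fin m) (Fin n₁) ℂ) (H₂₁ : Matrix (Fin m) (Fin n₂) ℂ)
    (hS₂ : S₂.PosSemidef) (hS : S.PosSemidef) : Ra H₁₁ H₂₁ S₂ S ≤ Rb H₂₁ S₂ := by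
  -- Factoring the interference as `Cᴴ C` and using `det (1 + XY) = det (1 + YX)` makes both
  -- determinants those of positive definite matrices that can be compared.
  obtain ⟨C, hC⟩ := exists_eq_conjTranspose_mul_self (rx_posSemidef H₂₁ hS₂)
  have hX := rx_posSemidef H₁₁ hS
  have hM := posDef_one_add_rx H₁₁ hS
  have h1 : Ra H₁₁ H₂₁ S₂ S = logDet (1 + C * (1 + rx H₁₁ S)⁻¹ * Cᴴ) := by
    rw [Ra, logDet, logDet, hC, ← Matrix.mul_assoc, det_one_add_mul_comm, ← Matrix.mul_assoc]
  have h2 : Rb H₂₁ S₂ = logDet ((1 + C * (1 + rx H₁₁ S)⁻¹ * Cᴴ) +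
      C * (1 - (1 + rx H₁₁ S)⁻¹) * Cᴴ) := by
    have : (1 + C * (1 + rx H₁₁ S)⁻¹ * Cᴴ) + C * (1 - (1 + rx H₁₁ S)⁻¹) * Cᴴ = 1 + C * Cᴴ := by
      noncomm_ring
    rw [this, Rb, logDet, logDet, hC, det_one_add_mul_comm]
  rw [h1, h2]
  exact logDet_le_logDet_add
    (PosDef.one.add_posSemidef (hM.inv.posSemidef.mul_mul_conjTranspose_same C))
    ((posSemidef_one_sub_inv hX).mul_mul_conjTranspose_same C)

open scoped MatrixOrder Matrix.Norms.L2Operator in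
lemma whitened_spec (H₁₁ : Matrix (Fin m) (Fin n₁) ℂ) (H₂₁ : Matrix (Fin m) (Fin n₂) ℂ)
    (hS₂ : S₂.PosSemidef) : ∃ R : Matrix (Fin m) (Fin m) ℂ,
      Rᴴ = R ∧ R * R = (1 + rx H₂₁ S₂)⁻¹ ∧ whitened H₁₁ H₂₁ S₂ = R * H₁₁ :=
  ⟨CFC.sqrt ((1 + rx H₂₁ S₂)⁻¹), (CFC.sqrt_nonneg _).posSemidef.1,
    CFC.sqrt_mul_sqrt_self _
      (nonneg_iff_posSemidef.mpr (posDef_one_add_rx H₂₁ hS₂).inv.posSemidef), rfl⟩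

lemma logDet_whitened (H₁₁ : Matrix (Fin m) (Fin n₁) ℂ) (H₂₁ : Matrix (Fin m) (Fin n₂) ℂ)
    (hS₂ : S₂.PosSemidef) (S : Matrix (Fin n₁) (Fin n₁) ℂ) :
    logDet (1 + rx (whitened H₁₁ H₂₁ S₂) S) = noiseRate H₁₁ H₂₁ S₂ S := by
  obtain ⟨R, hR, hRR, hW⟩ := whitened_spec H₁₁ H₂₁ hS₂
  have : rx (R * H₁₁) S = R * rx H₁₁ S * R := by
    rw [rx, rx, conjTranspose_mul, hR]; simp only [Matrix.mul_assoc]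
  rw [noiseRate, logDet, logDet, hW, this, det_one_add_mul_comm, ← Matrix.mul_assoc, hRR]

lemma whitened_ne_zero (hS₂ : S₂.PosSemidef) (hH : H₁₁ ≠ 0) : whitened H₁₁ H₂₁ S₂ ≠ 0 := by
  obtain ⟨R, -, hRR, hW⟩ := whitened_spec H₁₁ H₂₁ hS₂
  intro h0
  have hu : IsUnit (1 + rx H₂₁ S₂).det :=
    (Matrix.isUnit_iff_isUnit_det _).mp (posDef_one_add_rx H₂₁ hS₂).isUnit
  have h1 : (1 + rx H₂₁ S₂)⁻¹ * H₁₁ = 0 := by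
    rw [← hRR, Matrix.mul_assoc, ← hW, h0, Matrix.mul_zero]
  apply hH
  rw [← Matrix.one_mul H₁₁, ← mul_nonsing_inv _ hu, Matrix.mul_assoc, h1, Matrix.mul_zero]

/-- The test `r₂ ≤ Ra` says exactly that `A ≤ B - r₂`, so each branch picks the smaller expression.
-/
lemma omdRate_of_le {r₂ : ℝ} (hS₂ : S₂.PosSemidef) (hr : r₂ ≤ Rb H₂₁ S₂) (hS : S.PosSemidef) :
    omdRate H₁₁ H₂₁ S₂ r₂ S = min (ownRate H₁₁ S) (sumRate H₁₁ H₂₁ S₂ S - r₂) := by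
  have hRa := Ra_eq H₁₁ H₂₁ hS₂ hS
  by_cases h : r₂ ≤ Ra H₁₁ H₂₁ S₂ S
  · rw [omdRate, omdDecoding, if_pos h, decodingRate, min_eq_left (by linarith)]
  · rw [omdRate, omdDecoding, if_neg h, if_pos hr, decodingRate, min_eq_right (by linarith)]

lemma omdDecoding_eq_SUD {r₂ : ℝ} (hS₂ : S₂.PosSemidef) (hr : Rb H₂₁ S₂ < r₂)
    (hS : S.PosSemidef) : omdDecoding H₁₁ H₂₁ S₂ r₂ S = .SUD := by
  have hRa := Ra_le_Rb H₁₁ H₂₁ hS₂ hS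
  rw [omdDecoding, if_neg (by linarith), if_neg (by linarith)]

lemma IsOMDSolution.of_unique_max {P r₂ r : ℝ} {d : Decoding} (hS : S ∈ feasible n₁ P)
    (hle : ∀ T ∈ feasible n₁ P, omdRate H₁₁ H₂₁ S₂ r₂ T ≤ omdRate H₁₁ H₂₁ S₂ r₂ S)
    (heq : ∀ T ∈ feasible n₁ P, omdRate H₁₁ H₂₁ S₂ r₂ S ≤ omdRate H₁₁ H₂₁ S₂ r₂ T → T = S)
    (hr : omdRate H₁₁ H₂₁ S₂ r₂ S = r) (hd : omdDecoding H₁₁ H₂₁ S₂ r₂ S = d) :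
    IsOMDSolution H₁₁ H₂₁ S₂ P r₂ S r d where
  optimal_iff T := by
    constructor
    · rintro ⟨hT, hmax⟩
      exact heq T hT (hmax hS)
    · rintro rfl
      exact ⟨hS, hle⟩
  value_eq := hr
  decoding_eq := hd

lemma IsP3Solution.unique {P μ : ℝ} (hS₂ : S₂.PosSemidef) (hH : H₁₁ ≠ 0) (h0 : 0 ≤ μ)
    (h1 : μ ≤ 1) {T : Matrix (Fin n₁) (Fin n₁) ℂ} (hS : IsP3Solution H₁₁ H₂₁ S₂ P μ S)
    (hT : IsP3Solution H₁₁ H₂₁ S₂ P μ T) : S = T := by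
  simp only [IsP3Solution, ownRate, sumRate_eq_logDet] at hS hT
  exact weighted_rate_maximizer_unique PosDef.one (posDef_one_add_rx H₂₁ hS₂) hH h0
    (sub_nonneg.mpr h1) (by linarith) hS.1 hT.1 hS.2 hT.2

lemma exists_isP3Solution {P : ℝ} (hP : 0 ≤ P) (hS₂ : S₂.PosSemidef) (μ : ℝ) :
    ∃ S, IsP3Solution H₁₁ H₂₁ S₂ P μ S := by
  simp only [IsP3Solution, ownRate, sumRate_eq_logDet]
  exact (isCompact_feasible n₁ P).exists_isMaxOn (nonempty_feasible n₁ hP)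
    ((continuousOn_const.mul (continuousOn_rate PosDef.one H₁₁ P)).add
      (continuousOn_const.mul (continuousOn_rate (posDef_one_add_rx H₂₁ hS₂) H₁₁ P)))

/-- An upper bound `v > 0` of the dual function that is attained by the primal problem forces the
two multipliers to sum to one. -/
lemma multipliers_of_dualFun_le {P r₂ μ₁ μ₂ v : ℝ} (hv : 0 < v) (hS : S ∈ feasible n₁ P)
    (hA : v ≤ ownRate H₁₁ S) (hB : v ≤ sumRate H₁₁ H₂₁ S₂ S - r₂) (h₁ : 0 ≤ μ₁) (h₂ : 0 ≤ μ₂)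
    (h : dualFun H₁₁ H₂₁ S₂ P r₂ μ₁ μ₂ ≤ (v : EReal)) :
    μ₂ = 1 - μ₁ ∧ ∀ T ∈ feasible n₁ P,
      μ₁ * ownRate H₁₁ T + (1 - μ₁) * (sumRate H₁₁ H₂₁ S₂ T - r₂) ≤ v := by
  have hle : ∀ r, 0 ≤ r → ∀ T ∈ feasible n₁ P, lagrangian H₁₁ H₂₁ S₂ r₂ r T μ₁ μ₂ ≤ v :=
    fun r hr T hT => EReal.coe_le_coe_iff.mp ((le_iSup
      (fun x : {x : ℝ × Matrix (Fin n₁) (Fin n₁) ℂ // 0 ≤ x.1 ∧ x.2 ∈ feasible n₁ P} =>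
        ((lagrangian H₁₁ H₂₁ S₂ r₂ x.1.1 x.1.2 μ₁ μ₂ : ℝ) : EReal)) ⟨(r, T), hr, hT⟩).trans h)
  simp only [lagrangian] at hle
  have hA' := mul_le_mul_of_nonneg_left hA h₁
  have hB' := mul_le_mul_of_nonneg_left hB h₂
  have hge : 1 ≤ μ₁ + μ₂ := by
    by_contra! hlt
    have hpos : 0 < 1 - μ₁ - μ₂ := by linarith
    -- With multipliers summing to less than one the Lagrangian grows without bound in the rate;
    -- this rate already lifts it above `v`.
    have h3 := hle ((v + 1) / (1 - μ₁ - μ₂)) (by positivity) S hS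
    have h4 : (v + 1) / (1 - μ₁ - μ₂) * (1 - μ₁ - μ₂) = v + 1 := div_mul_cancel₀ _ hpos.ne'
    have := mul_nonneg h₁ hv.le
    have := mul_nonneg h₂ hv.le
    linarith
  have hle1 : μ₁ + μ₂ ≤ 1 := by
    -- At rate zero the bound reads `(μ₁ + μ₂) v ≤ v`, and `v > 0` can be cancelled.
    have h3 := hle 0 le_rfl S hS
    refine le_of_mul_le_mul_right ?_ hv
    linarith
  have hμ : μ₂ = 1 - μ₁ := by linarith
  refine ⟨hμ, fun T hT => ?_⟩
  have h3 := hle 0 le_rfl T hT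
  rw [hμ] at h3
  linarith

/-- The dual optimum of (P2) exists, and every dual optimum certifies the optimum of (P1). -/
lemma dual_optimum_spec {P r₂ : ℝ} (hP : 0 < P) (hS₂ : S₂.PosSemidef) (hH : H₁₁ ≠ 0)
    (hr : r₂ ≤ Rb H₂₁ S₂) : ∃ v, ∃ S ∈ feasible n₁ P,
      v = min (ownRate H₁₁ S) (sumRate H₁₁ H₂₁ S₂ S - r₂) ∧
      (∀ T ∈ feasible n₁ P, min (ownRate H₁₁ T) (sumRate H₁₁ H₂₁ S₂ T - r₂) ≤ v) ∧
      (∃ μ₁ μ₂, IsDualOptimal H₁₁ H₂₁ S₂ P r₂ μ₁ μ₂) ∧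
      ∀ μ₁ μ₂, IsDualOptimal H₁₁ H₂₁ S₂ P r₂ μ₁ μ₂ → 0 ≤ μ₁ ∧ μ₁ ≤ 1 ∧
        ∀ T ∈ feasible n₁ P,
          μ₁ * ownRate H₁₁ T + (1 - μ₁) * (sumRate H₁₁ H₂₁ S₂ T - r₂) ≤ v := by
  have hQ := posDef_one_add_rx H₂₁ hS₂
  have hfun : sumRate H₁₁ H₂₁ S₂ = fun S => logDet ((1 + rx H₂₁ S₂) + rx H₁₁ S) :=
    funext (sumRate_eq_logDet H₁₁ H₂₁ S₂)
  have hcA : ContinuousOn (ownRate H₁₁) (feasible n₁ P) := continuousOn_rate PosDef.one H₁₁ P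
  have hcB : ContinuousOn (sumRate H₁₁ H₂₁ S₂) (feasible n₁ P) := by
    rw [hfun]; exact continuousOn_rate hQ H₁₁ P
  have hA : ConcaveOn ℝ (feasible n₁ P) (ownRate H₁₁) := concaveOn_rate PosDef.one H₁₁ P
  have hB : ConcaveOn ℝ (feasible n₁ P) fun S => sumRate H₁₁ H₂₁ S₂ S - r₂ := by
    rw [hfun]
    exact (concaveOn_rate hQ H₁₁ P).sub (convexOn_const r₂ (convex_feasible n₁ P))
  have hcmin : ContinuousOn (fun S => min (ownRate H₁₁ S) (sumRate H₁₁ H₂₁ S₂ S - r₂))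
      (feasible n₁ P) := hcA.inf (hcB.sub continuousOn_const)
  obtain ⟨S, hS, hmax⟩ := (isCompact_feasible n₁ P).exists_isMaxOn
    (nonempty_feasible n₁ hP.le) hcmin
  have hmax' : ∀ T ∈ feasible n₁ P, min (ownRate H₁₁ T) (sumRate H₁₁ H₂₁ S₂ T - r₂) ≤
      min (ownRate H₁₁ S) (sumRate H₁₁ H₂₁ S₂ S - r₂) := fun T hT => hmax hT
  set v := min (ownRate H₁₁ S) (sumRate H₁₁ H₂₁ S₂ S - r₂) with hv
  have hvA : v ≤ ownRate H₁₁ S := min_le_left _ _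
  have hvB : v ≤ sumRate H₁₁ H₂₁ S₂ S - r₂ := min_le_right _ _
  -- Tested on a scaled identity: both rates strictly exceed their values at zero covariance, `0`
  -- and `Rb`, and `r₂ ≤ Rb`.
  have hv0 : 0 < v := by
    have hn : (0 : ℝ) < n₁ + 1 := by positivity
    have hε : 0 < P / (n₁ + 1) := by positivity
    have hI : ((P / (n₁ + 1)) • 1 : Matrix (Fin n₁) (Fin n₁) ℂ).PosSemidef :=
      posSemidef_real_smul PosSemidef.one hε.le
    have hIf : ((P / (n₁ + 1)) • 1 : Matrix (Fin n₁) (Fin n₁) ℂ) ∈ feasible n₁ P := by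
      refine ⟨hI, ?_⟩
      rw [trace_smul, trace_one, Complex.smul_re, Fintype.card_fin, Complex.natCast_re,
        smul_eq_mul, div_mul_eq_mul_div, div_le_iff₀ hn]
      linarith
    refine lt_of_lt_of_le (lt_min ?_ ?_) (hmax' _ hIf)
    · have := logDet_lt_logDet_add PosDef.one (rx_posSemidef H₁₁ hI) (rx_one_ne_zero hH hε)
      rwa [logDet_one] at this
    · have := logDet_lt_logDet_add hQ (rx_posSemidef H₁₁ hI) (rx_one_ne_zero hH hε)
      rw [← sumRate_eq_logDet] at this
      rw [Rb] at hr
      linarith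
  obtain ⟨a, ha0, ha1, ha⟩ :=
    exists_convex_combination_le (nonempty_feasible n₁ hP.le) hA hB hmax'
  have hdual : dualFun H₁₁ H₂₁ S₂ P r₂ a (1 - a) ≤ (v : EReal) := by
    refine iSup_le ?_
    rintro ⟨⟨r, T⟩, hr0, hT⟩
    refine EReal.coe_le_coe_iff.mpr ?_
    have := ha T hT
    simp only [lagrangian]
    linarith
  refine ⟨v, S, hS, rfl, hmax', ⟨a, 1 - a, ha0, by linarith, fun ν₁ ν₂ h₁ h₂ => ?_⟩, ?_⟩
  -- A pair with a smaller dual value would also sum to one, and then the Lagrangian at rate zero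
  -- and `S` is already at least `v`.
  · by_contra! hlt
    obtain ⟨rfl, hν⟩ := multipliers_of_dualFun_le hv0 hS hvA hvB h₁ h₂ (hlt.le.trans hdual)
    refine absurd (hlt.trans_le hdual) (not_lt.mpr ?_)
    refine le_trans (EReal.coe_le_coe_iff.mpr ?_) (le_iSup
      (fun x : {x : ℝ × Matrix (Fin n₁) (Fin n₁) ℂ // 0 ≤ x.1 ∧ x.2 ∈ feasible n₁ P} =>
        ((lagrangian H₁₁ H₂₁ S₂ r₂ x.1.1 x.1.2 ν₁ (1 - ν₁) : ℝ) : EReal)) ⟨(0, S), le_rfl, hS⟩)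
    have := mul_le_mul_of_nonneg_left hvA h₁
    have := mul_le_mul_of_nonneg_left hvB h₂
    simp only [lagrangian]
    linarith
  · rintro μ₁ μ₂ ⟨h₁, h₂, hopt⟩
    obtain ⟨rfl, hμ⟩ := multipliers_of_dualFun_le hv0 hS hvA hvB h₁ h₂
      ((hopt a (1 - a) ha0 (by linarith)).trans hdual)
    exact ⟨h₁, by linarith, hμ⟩

end

end OMD

/-! ### The four regimes. -/

theorem theorem3p1 {m n₁ n₂ : ℕ}
    (H₁₁ : Matrix (Fin m) (Fin n₁) ℂ) (H₂₁ : Matrix (Fin m) (Fin n₂) ℂ)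
    (S₂ : Matrix (Fin n₂) (Fin n₂) ℂ) (hS₂ : S₂.PosSemidef)
    (P₁ r₂ : ℝ) (hP₁ : 0 < P₁) (hH₁₁ : H₁₁ ≠ 0) :
    -- the two water-filling solutions exist
    (∃ S r, OMD.IsWaterFilling H₁₁ P₁ S r) ∧
    (∃ S r, OMD.IsWaterFilling (OMD.whitened H₁₁ H₂₁ S₂) P₁ S r) ∧
    ∀ (SSD SSUD : Matrix (Fin n₁) (Fin n₁) ℂ) (rSD rSUD : ℝ),
      OMD.IsWaterFilling H₁₁ P₁ SSD rSD →
      OMD.IsWaterFilling (OMD.whitened H₁₁ H₂₁ S₂) P₁ SSUD rSUD →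
      -- the order of the thresholds
      OMD.Ra H₁₁ H₂₁ S₂ SSD ≤ OMD.Ra H₁₁ H₂₁ S₂ SSUD ∧
      OMD.Ra H₁₁ H₂₁ S₂ SSUD ≤ OMD.Rb H₂₁ S₂ ∧
      -- first regime
      (0 < r₂ → r₂ < OMD.Ra H₁₁ H₂₁ S₂ SSD →
        OMD.IsOMDSolution H₁₁ H₂₁ S₂ P₁ r₂ SSD rSD .SD) ∧
      -- second regime
      (OMD.Ra H₁₁ H₂₁ S₂ SSD ≤ r₂ → r₂ ≤ OMD.Ra H₁₁ H₂₁ S₂ SSUD →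
        (∃ μ₁ μ₂, OMD.IsDualOptimal H₁₁ H₂₁ S₂ P₁ r₂ μ₁ μ₂) ∧
        ∀ μ₁ μ₂, OMD.IsDualOptimal H₁₁ H₂₁ S₂ P₁ r₂ μ₁ μ₂ →
          (∃ S, OMD.IsP3Solution H₁₁ H₂₁ S₂ P₁ μ₁ S) ∧
          ∀ S, OMD.IsP3Solution H₁₁ H₂₁ S₂ P₁ μ₁ S →
            OMD.IsOMDSolution H₁₁ H₂₁ S₂ P₁ r₂ S (OMD.ownRate H₁₁ S) .SD) ∧
      -- third regime
      (OMD.Ra H₁₁ H₂₁ S₂ SSUD < r₂ → r₂ ≤ OMD.Rb H₂₁ S₂ →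
        OMD.IsOMDSolution H₁₁ H₂₁ S₂ P₁ r₂ SSUD (rSUD + OMD.Rb H₂₁ S₂ - r₂) .JD) ∧
      -- fourth regime
      (OMD.Rb H₂₁ S₂ < r₂ →
        OMD.IsOMDSolution H₁₁ H₂₁ S₂ P₁ r₂ SSUD rSUD .SUD) := by
  refine ⟨OMD.exists_isWaterFilling hH₁₁ hP₁.le,
    OMD.exists_isWaterFilling (OMD.whitened_ne_zero hS₂ hH₁₁) hP₁.le, ?_⟩
  intro SSD SSUD rSD rSUD hSD hSUD
  obtain ⟨hSDf, hrSD, hSDmax⟩ := hSD.optimal hP₁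
  obtain ⟨hSUDf, hrSUD, hSUDmax⟩ := hSUD.optimal hP₁
  have hA : ∀ T ∈ OMD.feasible n₁ P₁, OMD.ownRate H₁₁ T ≤ OMD.ownRate H₁₁ SSD :=
    fun T hT => hSDmax hT
  have hB : ∀ T ∈ OMD.feasible n₁ P₁,
      OMD.sumRate H₁₁ H₂₁ S₂ T ≤ OMD.sumRate H₁₁ H₂₁ S₂ SSUD := by
    intro T hT
    have h := hSUDmax hT
    simp only [Set.mem_ofPred_eq, OMD.logDet_whitened _ _ hS₂] at h
    rw [OMD.noiseRate_eq _ _ hS₂ hT.1, OMD.noiseRate_eq _ _ hS₂ hSUDf.1] at h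
    linarith
  have hrSUD' : rSUD = OMD.sumRate H₁₁ H₂₁ S₂ SSUD - OMD.Rb H₂₁ S₂ := by
    rw [hrSUD, OMD.logDet_whitened _ _ hS₂, OMD.noiseRate_eq _ _ hS₂ hSUDf.1]
  -- Uniqueness for `A` alone is the weighted problem with weight one; weight zero does the same for
  -- `B`.
  have hAu : ∀ T ∈ OMD.feasible n₁ P₁, OMD.ownRate H₁₁ SSD ≤ OMD.ownRate H₁₁ T → T = SSD := by
    intro T hT hle
    refine OMD.IsP3Solution.unique (H₂₁ := H₂₁) hS₂ hH₁₁ zero_le_one le_rfl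
      ⟨hT, fun X hX => ?_⟩ ⟨hSDf, fun X hX => ?_⟩
    · simpa using (hA X hX).trans hle
    · simpa using hA X hX
  have hBu : ∀ T ∈ OMD.feasible n₁ P₁,
      OMD.sumRate H₁₁ H₂₁ S₂ SSUD ≤ OMD.sumRate H₁₁ H₂₁ S₂ T → T = SSUD := by
    intro T hT hle
    refine OMD.IsP3Solution.unique (H₂₁ := H₂₁) hS₂ hH₁₁ le_rfl zero_le_one
      ⟨hT, fun X hX => ?_⟩ ⟨hSUDf, fun X hX => ?_⟩
    · simpa using (hB X hX).trans hle
    · simpa using hB X hX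
  have hRaSD := OMD.Ra_eq H₁₁ H₂₁ hS₂ hSDf.1
  have hRaSUD := OMD.Ra_eq H₁₁ H₂₁ hS₂ hSUDf.1
  have hRaRb := OMD.Ra_le_Rb H₁₁ H₂₁ hS₂ hSUDf.1
  have hRaRa : OMD.Ra H₁₁ H₂₁ S₂ SSD ≤ OMD.Ra H₁₁ H₂₁ S₂ SSUD := by
    have := hA _ hSUDf
    have := hB _ hSDf
    linarith
  refine ⟨hRaRa, hRaRb, ?_, ?_, ?_, ?_⟩
  · intro _ hr
    have hrb : r₂ ≤ OMD.Rb H₂₁ S₂ := by linarith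
    have hval : OMD.omdRate H₁₁ H₂₁ S₂ r₂ SSD = OMD.ownRate H₁₁ SSD := by
      rw [OMD.omdRate_of_le hS₂ hrb hSDf.1, min_eq_left (by linarith)]
    refine .of_unique_max hSDf (fun T hT => ?_) (fun T hT h => ?_) (hval.trans hrSD.symm)
      (if_pos hr.le)
    · rw [hval, OMD.omdRate_of_le hS₂ hrb hT.1]
      exact (min_le_left _ _).trans (hA T hT)
    · rw [hval, OMD.omdRate_of_le hS₂ hrb hT.1] at h
      exact hAu T hT (h.trans (min_le_left _ _))
  · intro hr1 hr2
    have hrb : r₂ ≤ OMD.Rb H₂₁ S₂ := by linarith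
    obtain ⟨v, S', hS'f, hv, hmax, hex, hdual⟩ := OMD.dual_optimum_spec hP₁ hS₂ hH₁₁ hrb
    refine ⟨hex, fun μ₁ μ₂ hμ => ?_⟩
    obtain ⟨h0, h1, hle⟩ := hdual μ₁ μ₂ hμ
    refine ⟨OMD.exists_isP3Solution hP₁.le hS₂ μ₁, fun S hS => ?_⟩
    -- A maximin point attains the bound `v` on the weighted sum, hence solves the weighted problem,
    -- whose solution is unique.
    have huniq : ∀ T ∈ OMD.feasible n₁ P₁,
        v ≤ min (OMD.ownRate H₁₁ T) (OMD.sumRate H₁₁ H₂₁ S₂ T - r₂) → T = S := by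
      intro T hT hvT
      refine OMD.IsP3Solution.unique hS₂ hH₁₁ h0 h1 ⟨hT, fun X hX => ?_⟩ hS
      have hX' := hle X hX
      have hTA := mul_le_mul_of_nonneg_left (hvT.trans (min_le_left _ _)) h0
      have hTB := mul_le_mul_of_nonneg_left (hvT.trans (min_le_right _ _)) (sub_nonneg.mpr h1)
      simp only [Set.mem_ofPred_eq]
      linarith
    obtain rfl : S' = S := huniq S' hS'f hv.le
    have hval : OMD.omdRate H₁₁ H₂₁ S₂ r₂ S' = v := by
      rw [OMD.omdRate_of_le hS₂ hrb hS'f.1, hv]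
    have hvA : v ≤ OMD.ownRate H₁₁ S' := hv.le.trans (min_le_left _ _)
    have hvB : v ≤ OMD.sumRate H₁₁ H₂₁ S₂ S' - r₂ := hv.le.trans (min_le_right _ _)
    have hRaS := OMD.Ra_eq H₁₁ H₂₁ hS₂ hS'f.1
    -- For `μ₁ = 0` the point is `SSUD`, and the regime's upper threshold applies; for `μ₁ > 0`
    -- complementary slackness gives `A ≤ v ≤ B - r₂`.
    have hSD' : r₂ ≤ OMD.Ra H₁₁ H₂₁ S₂ S' := by
      rcases h0.eq_or_lt with rfl | hpos
      · have : S' = SSUD := hBu S' hS'f (by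
          have := hS.2 hSUDf
          simpa using this)
        rw [this]
        exact hr2
      · have h3 := hle S' hS'f
        have h4 := mul_le_mul_of_nonneg_left hvB (sub_nonneg.mpr h1)
        have h5 : OMD.ownRate H₁₁ S' ≤ v := le_of_mul_le_mul_left (by linarith) hpos
        linarith
    refine .of_unique_max hS'f (fun T hT => ?_) (fun T hT h => ?_) ?_ (if_pos hSD')
    · rw [hval, OMD.omdRate_of_le hS₂ hrb hT.1]
      exact hmax T hT
    · rw [hval, OMD.omdRate_of_le hS₂ hrb hT.1] at h
      exact huniq T hT h
    · rw [OMD.omdRate_of_le hS₂ hrb hS'f.1, min_eq_left (by linarith)]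
  · intro hr hrb
    have hval : OMD.omdRate H₁₁ H₂₁ S₂ r₂ SSUD = OMD.sumRate H₁₁ H₂₁ S₂ SSUD - r₂ := by
      rw [OMD.omdRate_of_le hS₂ hrb hSUDf.1, min_eq_right (by linarith)]
    refine .of_unique_max hSUDf (fun T hT => ?_) (fun T hT h => ?_) (by rw [hval, hrSUD']; ring)
      (by rw [OMD.omdDecoding, if_neg (not_le.mpr hr), if_pos hrb])
    · rw [hval, OMD.omdRate_of_le hS₂ hrb hT.1]
      exact (min_le_right _ _).trans (sub_le_sub_right (hB T hT) _)
    · rw [hval, OMD.omdRate_of_le hS₂ hrb hT.1] at h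
      exact hBu T hT ((sub_le_sub_iff_right _).mp (h.trans (min_le_right _ _)))
  · intro hr
    have hval : ∀ T ∈ OMD.feasible n₁ P₁, OMD.omdRate H₁₁ H₂₁ S₂ r₂ T =
        OMD.sumRate H₁₁ H₂₁ S₂ T - OMD.Rb H₂₁ S₂ := by
      intro T hT
      rw [OMD.omdRate, OMD.omdDecoding_eq_SUD hS₂ hr hT.1, OMD.decodingRate,
        OMD.noiseRate_eq _ _ hS₂ hT.1]
    refine .of_unique_max hSUDf (fun T hT => ?_) (fun T hT h => ?_)
      ((hval _ hSUDf).trans hrSUD'.symm) (OMD.omdDecoding_eq_SUD hS₂ hr hSUDf.1)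
    · rw [hval _ hT, hval _ hSUDf]
      exact sub_le_sub_right (hB T hT) _
    · rw [hval _ hT, hval _ hSUDf] at h
      exact hBu T hT ((sub_le_sub_iff_right _).mp h)
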